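/- **Setting.** Let $n\ge 3$ and $A=C^\infty(\mathbb R)\otimes\mathbb C(\mathbb Z_n)$, the algebra of complex functions $f(t,i)$ on $\mathbb R\times\mathbb Z_n$ smooth in $t$, with $R_\pm f(t,i)=f(t,i\pm1)$, $\partial_\pm=R_\pm-\mathrm{id}$. Let $\Omega$ be the tensor product calculus: $\Omega^1$ is the free left $A$-module on $dt,e^+,e^-$ with right action $dt\,f=f\,dt$, $e^\pm f=R_\pm(f)e^\pm$, the basic 1-forms anticommute and are closed, $df=(\partial_tf)dt+(\partial_+f)e^++(\partial_-f)e^-$, and $dt^*=dt$, $(e^\pm)^*=-e^\mp$, $(\omega\otimes\eta)^\dagger=\eta^*\otimes\omega^*$. A *quantum metric* is $g\in\Omega^1\otimes_A\Omega^1$ with $g^\dagger=g$ that has a bimodule inverse $(\ ,\ ):\Omega^1\otimes_A\Omega^1\to A$; it is *edge-symmetric* if $h_-=R_-(h_+)$, where $h_\pm$ is the coefficient of $e^\pm\otimes e^\mp$ in $g$. A *$*$-preserving QLC* for $g$ is a bimodule connection $\nabla$ on $\Omega^1$ with generalised braiding $\sigma$ (a bimodule map) such that $\wedge\nabla=d$,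 $\nabla g=0$ and $\nabla\circ *=\sigma\circ\dagger\circ\nabla$. As $\mathbb Z_n$ part we always take the standard $*$-preserving QLC on $\mathbb Z_n$: only those $(\nabla,\sigma)$ are considered for which $\sigma$ is the flip on $dt\otimes dt$, $dt\otimes e^\pm$, $e^\pm\otimes dt$, and, with $\rho=R_+(h_+)/h_+$, $$\sigma(e^+\otimes e^+)=\rho\, e^+\otimes e^+,\quad \sigma(e^\pm\otimes e^\mp)=e^\mp\otimes e^\pm,\quad \sigma(e^-\otimes e^-)=R_-^2(\rho^{-1})\,e^-\otimes e^-,$$ and $\nabla e^+$, $\nabla e^-$ agree with $(1-\rho)e^+\otimes e^+$, $(1-R_-^2(\rho^{-1}))e^-\otimes e^-$ respectively up to terms involving $dt$. **Theorem.** (1) Let $g$ be an edge-symmetric quantum metric on $\mathbb R\times\mathbb Z_n$ admitting such a $*$-preserving QLC. Then there are a sign $\varepsilon\in\{1,-1\}$, a smooth $\tau:\mathbb R\to\mathbb R$ with $d\tau/dt>0$ everywhere (a new time coordinate), a smooth $\alpha:\mathbb R\to\mathbb R$ and $\beta:\mathbb Z_n\to\mathbb R$ with $\sum_i\beta(i)=0$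 such that $a(t,i)=\alpha(t)+\beta(i)$ vanishes nowhere and $$g=\varepsilon\, d\tau\otimes d\tau-a\,e^+\otimes e^--R_-(a)\,e^-\otimes e^+ .$$ (So $\varepsilon=-1$ exactly when the coefficient of $dt\otimes dt$ is negative, the cosmological case.) (2) Conversely, for all such $\tau,\alpha,\beta$ the tensor $g=-d\tau\otimes d\tau-a\,e^+\otimes e^--R_-(a)\,e^-\otimes e^+$ is an edge-symmetric quantum metric, its inverse $(\ ,\ )$ is unique, and it has exactly one such $*$-preserving QLC. Let $R_\nabla=(d\otimes\mathrm{id}-\mathrm{id}\wedge\nabla)\nabla$, let $i(\xi\wedge\eta)=\frac12(\xi\otimes\eta-\eta\otimes\xi)$ on basic 1-forms be the lift, $\mathrm{Ricci}=((\ ,\ )\otimes\mathrm{id})(\mathrm{id}\otimes i\otimes\mathrm{id})(\mathrm{id}\otimes R_\nabla)g$, $S=(\ ,\ )\mathrm{Ricci}$ and $\Delta=(\ ,\ )\nabla d$. Writing $\partial_\tau=(d\tau/dt)^{-1}\partial_t$ and a dot for $\partial_\tau$, $$\begin{aligned}2S=&-\ddot\alpha\Big(\frac1{\alpha+\beta}+\frac1{\alpha+R_-\beta}\Big)+\frac{\dot\alpha^2}4\Big(\frac1{(\alpha+\beta)^2}+\frac1{(\alpha+R_-\beta)^2}\Big)\\&+\frac{s}{(\alpha+\beta)^2(\alpha+R_+\beta)}+R_-\Big(\frac{s}{(\alpha+\beta)^2(\alpha+R_-\beta)}\Big),\end{aligned}$$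 $$\Delta f=-\partial_\tau^2f+\Big(\frac1{\alpha+\beta}+\frac1{\alpha+R_-\beta}\Big)\Big(-\frac{\dot\alpha}2\partial_\tau f+\Delta_{\mathbb Z_n}f\Big)\quad(f\in A),$$ where $\Delta_{\mathbb Z_n}f=R_+f+R_-f-2f$ and $$s=(\alpha+R_+\beta)(\alpha+R_-\beta)-(\alpha+\beta)^2=\alpha\,\Delta_{\mathbb Z_n}\beta+(R_+\beta)(R_-\beta)-\beta^2 .$$ -/

import Mathlib

open scoped ContDiff

noncomputable section

namespace QGeom

/-! ### The algebra of functions on `ℝ × ℤ_n` -/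

/-- The algebra `A = C^∞(ℝ) ⊗ ℂ(ℤ_n)`: complex functions of `(t, i)` that are smooth in `t`. -/
def smoothFn (n : ℕ) : Subalgebra ℂ (ℝ → ZMod n → ℂ) where
  carrier := {f | ∀ i, ContDiff ℝ ∞ (fun t => f t i)}
  mul_mem' := fun hf hg i => (hf i).mul (hg i)
  add_mem' := fun hf hg i => (hf i).add (hg i)
  algebraMap_mem' := fun c _ => (contDiff_const : ContDiff ℝ ∞ (fun _ : ℝ => c))

/-- Elements of `A`. -/
abbrev Fn (n : ℕ) : Type := ↥(smoothFn n)

variable {n : ℕ}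

/-- A smooth real function of time, as an element of `A`. -/
def ofTime (n : ℕ) (u : ℝ → ℝ) (hu : ContDiff ℝ ∞ u) : Fn n :=
  ⟨fun t _ => (u t : ℂ), fun _ => Complex.ofRealCLM.contDiff.comp hu⟩

/-- A real function on `ℤ_n`, as an element of `A`. -/
def ofSpace (b : ZMod n → ℝ) : Fn n :=
  ⟨fun _ i => (b i : ℂ), fun _ => contDiff_const⟩

/-- The translation operator `R_k`, `(R_k f)(t, i) = f(t, i + k)`. -/
def shift (k : ZMod n) (f : Fn n) : Fn n :=
  ⟨fun t i => f.1 t (i + k), fun i => f.2 (i + k)⟩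

/-- Pointwise complex conjugation, the `*`-involution of `A`. -/
def conj (f : Fn n) : Fn n :=
  ⟨fun t i => star (f.1 t i), fun i => Complex.conjCLE.contDiff.comp (f.2 i)⟩

/-- The partial derivative `∂f/∂t`. -/
def dtime (f : Fn n) : Fn n :=
  ⟨fun t i => deriv (fun s => f.1 s i) t, fun i => (contDiff_infty_iff_deriv.1 (f.2 i)).2⟩

/-! ### Differential forms and tensors

The basic 1-forms are `dt`, `e⁺`, `e⁻`.  They form a basis of `Ω¹` as a left `A`-module, and
`e^b f = R_{deg b}(f) e^b` with degrees `0, 1, -1`.  All bimodules below are free as left modules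
on products of basic 1-forms, and an element is given by its left coefficients. -/

/-- Labels of the basic 1-forms `dt`, `e⁺`, `e⁻`. -/
inductive Ix : Type
  | t
  | p
  | m
  deriving DecidableEq

instance : Fintype Ix := ⟨{.t, .p, .m}, fun x => by cases x <;> decide⟩

/-- Labels of the basic 2-forms `dt ∧ e⁺`, `dt ∧ e⁻`, `e⁺ ∧ e⁻`. -/
inductive Ix2 : Type
  | tp
  | tm
  | pm
  deriving DecidableEq

/-- `e^b f = R_{deg b}(f) e^b`. -/
def deg (n : ℕ) : Ix → ZMod n
  | .t => 0
  | .p => 1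
  | .m => -1

/-- `Ω¹`: the family `w` stands for `∑_b w_b e^b`. -/
abbrev Form1 (n : ℕ) : Type := Ix → Fn n

/-- `Ω¹ ⊗_A Ω¹`: the family `T` stands for `∑_{b,c} T_{bc} e^b ⊗ e^c`. -/
abbrev Tens (n : ℕ) : Type := Ix → Ix → Fn n

/-- `Ω²`, the degree-two part of the Grassmann algebra on `dt, e⁺, e⁻` over `A`. -/
abbrev Form2 (n : ℕ) : Type := Ix2 → Fn n

/-- `Ω² ⊗_A Ω¹`. -/
abbrev Tens21 (n : ℕ) : Type := Ix2 → Ix → Fn n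

/-- The basic 1-form `e^b` (with `e^t = dt`). -/
def e (b : Ix) : Form1 n := fun c => if c = b then 1 else 0

/-- The left action of `A` on `Ω¹`. -/
def lmul1 (f : Fn n) (w : Form1 n) : Form1 n := fun b => f * w b

/-- The left action of `A` on `Ω¹ ⊗_A Ω¹`. -/
def lmul2 (f : Fn n) (T : Tens n) : Tens n := fun b c => f * T b c

/-- The right action of `A` on `Ω¹`. -/
def rmul1 (w : Form1 n) (f : Fn n) : Form1 n := fun b => w b * shift (deg n b) f

/-- The right action of `A` on `Ω¹ ⊗_A Ω¹`. -/
def rmul2 (T : Tens n) (f : Fn n) : Tens n := fun b c => T b c * shift (deg n b + deg n c) f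

/-- `w ⊗ η`, using `(f e^b) ⊗ (g e^c) = f R_{deg b}(g) e^b ⊗ e^c`. -/
def tmul (w η : Form1 n) : Tens n := fun b c => w b * shift (deg n b) (η c)

/-- `tmul` is balanced over `A`. -/
theorem tmul_balanced (w η : Form1 n) (f : Fn n) : tmul (rmul1 w f) η = tmul w (lmul1 f η) := by
  funext b c
  apply Subtype.ext
  funext t i
  exact mul_assoc _ _ _

/-- The right action on a tensor product is the one on the second factor. -/
theorem tmul_rmul (w η : Form1 n) (f : Fn n) : tmul w (rmul1 η f) = rmul2 (tmul w η) f := by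
  funext b c
  apply Subtype.ext
  funext t i
  change (w b).1 t i * ((η c).1 t (i + deg n b) * f.1 t (i + deg n b + deg n c)) =
    (w b).1 t i * (η c).1 t (i + deg n b) * f.1 t (i + (deg n b + deg n c))
  rw [add_assoc, mul_assoc]

/-- The exterior derivative on functions, `df = ḟ dt + (∂₊f) e⁺ + (∂₋f) e⁻`, `∂_± = R_± - id`. -/
def d0 (f : Fn n) : Form1 n
  | .t => dtime f
  | .p => shift 1 f - f
  | .m => shift (-1) f - f

/-- The wedge product `Ω¹ ⊗_A Ω¹ → Ω²`; the basic 1-forms anticommute. -/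
def wedge (T : Tens n) : Form2 n
  | .tp => T .t .p - T .p .t
  | .tm => T .t .m - T .m .t
  | .pm => T .p .m - T .m .p

/-- The exterior derivative on 1-forms, `d(∑ w_b e^b) = ∑ dw_b ∧ e^b` (the basic forms are closed). -/
def d1 (w : Form1 n) : Form2 n := ∑ b, wedge (tmul (d0 (w b)) (e b))

/-- The bimodule lift `Ω² → Ω¹ ⊗_A Ω¹`, `e^b ∧ e^c ↦ (e^b ⊗ e^c - e^c ⊗ e^b) / 2`. -/
def lift2 (F : Form2 n) : Tens n
  | .t, .p => (1 / 2 : ℂ) • F .tp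
  | .p, .t => -((1 / 2 : ℂ) • F .tp)
  | .t, .m => (1 / 2 : ℂ) • F .tm
  | .m, .t => -((1 / 2 : ℂ) • F .tm)
  | .p, .m => (1 / 2 : ℂ) • F .pm
  | .m, .p => -((1 / 2 : ℂ) • F .pm)
  | _, _ => 0

/-! ### The `*`-structure: `dt* = dt`, `(e^±)* = -e^∓` -/

/-- The label of `±(e^b)*`. -/
def opp : Ix → Ix
  | .t => .t
  | .p => .m
  | .m => .p

/-- The sign in `(e^b)* = ± e^{opp b}`. -/
def sgn (n : ℕ) : Ix → Fn n
  | .t => 1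
  | .p => -1
  | .m => -1

/-- `(∑ w_b e^b)* = ∑ (e^b)* (w_b)*`. -/
def star1 (w : Form1 n) : Form1 n := fun b => sgn n b * shift (deg n b) (conj (w (opp b)))

/-- The operation `†` on `Ω¹ ⊗_A Ω¹`, determined by `(w ⊗ η)† = η* ⊗ w*`. -/
def dagger (T : Tens n) : Tens n := fun b c =>
  sgn n b * sgn n c * shift (deg n b + deg n c) (conj (T (opp c) (opp b)))

theorem dagger_tmul (w η : Form1 n) : dagger (tmul w η) = tmul (star1 η) (star1 w) := by
  funext b c
  apply Subtype.ext
  funext t i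
  have h : deg n (opp c) = -deg n c := by cases c <;> simp [deg, opp]
  have hs : ∀ j, (sgn n c).1 t j = (sgn n c).1 t i := by intro j; cases c <;> rfl
  change (sgn n b).1 t i * (sgn n c).1 t i * star ((w (opp c)).1 t (i + (deg n b + deg n c)) *
      (η (opp b)).1 t (i + (deg n b + deg n c) + deg n (opp c))) =
    (sgn n b).1 t i * star ((η (opp b)).1 t (i + deg n b)) *
      ((sgn n c).1 t (i + deg n b) * star ((w (opp c)).1 t (i + deg n b + deg n c)))
  rw [h, hs (i + deg n b), star_mul', add_assoc i, ← add_assoc i (deg n b) (deg n c), add_neg_cancel_right]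
  ring

/-! ### Quantum metrics -/

/-- A bimodule map `Ω¹ ⊗_A Ω¹ → A`. -/
structure IsBimodMapFn (φ : Tens n → Fn n) : Prop where
  map_add : ∀ S T, φ (S + T) = φ S + φ T
  map_smul : ∀ (f : Fn n) T, φ (lmul2 f T) = f * φ T
  map_rmul : ∀ T (f : Fn n), φ (rmul2 T f) = φ T * f

/-- A bimodule map `Ω¹ ⊗_A Ω¹ → Ω¹ ⊗_A Ω¹`. -/
structure IsBimodMap (σ : Tens n → Tens n) : Prop where
  map_add : ∀ S T, σ (S + T) = σ S + σ T
  map_smul : ∀ (f : Fn n) T, σ (lmul2 f T) = lmul2 f (σ T)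
  map_rmul : ∀ T (f : Fn n), σ (rmul2 T f) = rmul2 (σ T) f

/-- `( , )` is the bimodule inverse of `g = g¹ ⊗ g²`:
`(w, g¹) g² = w = g¹ (g², w)` for all `w ∈ Ω¹`. -/
structure IsInverseMetric (g : Tens n) (ip : Tens n → Fn n) : Prop where
  bimod : IsBimodMapFn ip
  left_inv : ∀ w : Form1 n, ∑ c, lmul1 (ip (tmul w (fun b => g b c))) (e c) = w
  right_inv : ∀ w : Form1 n, ∑ c, rmul1 (fun b => g b c) (ip (tmul (e c) w)) = w

/-- A (real) quantum metric: a bimodule-invertible `g ∈ Ω¹ ⊗_A Ω¹` with `g† = g`. -/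
structure IsQuantumMetric (g : Tens n) : Prop where
  invertible : ∃ ip, IsInverseMetric g ip
  real : dagger g = g

/-- Edge-symmetry of the `ℤ_n` part: the weight of an edge does not depend on its direction. -/
def IsEdgeSymmetric (g : Tens n) : Prop := g .m .p = shift (-1) (g .p .m)

/-! ### Quantum Levi-Civita connections -/

/-- `∇` is a bimodule connection on `Ω¹` with generalised braiding `σ`. -/
structure IsBimodConn (nabla : Form1 n → Tens n) (σ : Tens n → Tens n) : Prop where
  braiding : IsBimodMap σ
  map_add : ∀ w η, nabla (w + η) = nabla w + nabla η
  left_leibniz : ∀ (f : Fn n) w, nabla (lmul1 f w) = tmul (d0 f) w + lmul2 f (nabla w)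
  right_leibniz : ∀ w (f : Fn n), nabla (rmul1 w f) = rmul2 (nabla w) f + σ (tmul w (d0 f))

/-- The component on `e^b ⊗ e^c ⊗ e^x` of `∇g¹ ⊗ g² + (σ ⊗ id)(g¹ ⊗ ∇g²)`. -/
def nablaMetric (nabla : Form1 n → Tens n) (σ : Tens n → Tens n) (g : Tens n)
    (b c x : Ix) : Fn n :=
  nabla (fun y => g y x) b c +
    ∑ z, σ (tmul (fun y => g y z) (fun y => nabla (e z) y x)) b c

/-- A `*`-preserving quantum Levi-Civita connection for `g`: a bimodule connection that is
torsion free (`∧∇ = d`), metric compatible (`∇g = 0`) and satisfies `∇ ∘ * = σ ∘ † ∘ ∇`. -/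
structure IsStarQLC (g : Tens n) (nabla : Form1 n → Tens n) (σ : Tens n → Tens n) : Prop where
  conn : IsBimodConn nabla σ
  torsion_free : ∀ w, wedge (nabla w) = d1 w
  metric_compat : ∀ b c x, nablaMetric nabla σ g b c x = 0
  star_preserving : ∀ w, nabla (star1 w) = σ (dagger (nabla w))

/-- The connection is of product type over the standard `*`-preserving connection on `ℤ_n`:
`σ` is the flip when one of the arguments is `dt`, while on `e^±` it is
`σ(e⁺⊗e⁺) = ρ e⁺⊗e⁺`, `σ(e^±⊗e^∓) = e^∓⊗e^±`, `σ(e⁻⊗e⁻) = R_-²(ρ⁻¹) e⁻⊗e⁻`,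
and the `e^± ⊗ e^±` components of `∇e^±` are those of
`∇e⁺ = (1-ρ) e⁺⊗e⁺`, `∇e⁻ = (1-R_-²(ρ⁻¹)) e⁻⊗e⁻`.
Here `ρ = R_+(h)/h` for the coefficient `h` of `e⁺ ⊗ e⁻` in the metric,
and `κ` below is `R_-²(ρ⁻¹)`. No condition is put on components involving `dt`
of the tensors `∇dt`, `∇e^±`, or on any component of `∇dt`. -/
structure ExtendsZn (g : Tens n) (nabla : Form1 n → Tens n) (σ : Tens n → Tens n) : Prop where
  flip_left : ∀ b, σ (tmul (e .t) (e b)) = tmul (e b) (e .t)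
  flip_right : ∀ b, σ (tmul (e b) (e .t)) = tmul (e .t) (e b)
  zn_part : ∃ ρ κ : Fn n, ρ * g .p .m = shift 1 (g .p .m) ∧ κ * shift (-2) ρ = 1 ∧
    σ (tmul (e .p) (e .p)) = lmul2 ρ (tmul (e .p) (e .p)) ∧
    σ (tmul (e .p) (e .m)) = tmul (e .m) (e .p) ∧
    σ (tmul (e .m) (e .p)) = tmul (e .p) (e .m) ∧
    σ (tmul (e .m) (e .m)) = lmul2 κ (tmul (e .m) (e .m)) ∧
    (∀ b c, b ≠ .t → c ≠ .t →
      nabla (e .p) b c = lmul2 (1 - ρ) (tmul (e .p) (e .p)) b c) ∧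
    (∀ b c, b ≠ .t → c ≠ .t →
      nabla (e .m) b c = lmul2 (1 - κ) (tmul (e .m) (e .m)) b c)

/-! ### Curvature and Laplacian -/

/-- The Riemann curvature `R_∇ = (d ⊗ id - id ∧ ∇)∇ : Ω¹ → Ω² ⊗_A Ω¹`. -/
def riemann (nabla : Form1 n → Tens n) (w : Form1 n) : Tens21 n := fun q c =>
  d1 (fun b => nabla w b c) q -
    ∑ x, wedge (tmul (fun b => nabla w b x) (fun b => nabla (e x) b c)) q

/-- `Ricci = (( , ) ⊗ id)(id ⊗ i ⊗ id)(id ⊗ R_∇)g`, with `i` the lift. -/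
def ricci (g : Tens n) (ip : Tens n → Fn n) (nabla : Form1 n → Tens n) : Tens n := fun b c =>
  ∑ x, ip (tmul (fun y => g y x)
    (fun y => lift2 (fun q => riemann nabla (e x) q c) y b))

/-- The scalar curvature `S = ( , ) Ricci`. -/
def scalarCurv (g : Tens n) (ip : Tens n → Fn n) (nabla : Form1 n → Tens n) : Fn n :=
  ip (ricci g ip nabla)

/-- The Laplacian `Δ = ( , ) ∇ d`. -/
def laplacian (ip : Tens n → Fn n) (nabla : Form1 n → Tens n) (f : Fn n) : Fn n :=
  ip (nabla (d0 f))

/-! ### Block diagonal metrics -/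

/-- `ε dT ⊗ dT - a e⁺ ⊗ e⁻ - R_-(a) e⁻ ⊗ e⁺`. -/
def blockMetric (ε : ℂ) (T a : Fn n) : Tens n :=
  lmul2 (algebraMap ℂ (Fn n) ε) (tmul (d0 T) (d0 T)) - lmul2 a (tmul (e .p) (e .m))
    - lmul2 (shift (-1) a) (tmul (e .m) (e .p))

/-- `du/dτ = (du/dt) / (dτ/dt)`, the derivative with respect to the time coordinate `τ`. -/
def dtau {E : Type*} [NormedAddCommGroup E] [NormedSpace ℝ E] (τ : ℝ → ℝ) (u : ℝ → E) : ℝ → E :=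
  fun t => (deriv τ t)⁻¹ • deriv u t

/-- The usual Laplacian `R_+ b + R_- b - 2 b` on `ℤ_n`. -/
def lapZn {E : Type*} [AddCommGroup E] (b : ZMod n → E) : ZMod n → E :=
  fun i => b (i + 1) + b (i - 1) - (b i + b i)

/-- `s = R_+(a) R_-(a) - a²`. -/
def sFun (a : ZMod n → ℝ) : ZMod n → ℝ := fun i => a (i + 1) * a (i - 1) - a i ^ 2

/-- The right hand side of the formula for `2S`, for `a = α + β`, with dots denoting `d/dτ`. -/
def twiceScalarFormula (τ α : ℝ → ℝ) (β : ZMod n → ℝ) (t : ℝ) (i : ZMod n) : ℝ :=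
  -dtau τ (dtau τ α) t * (1 / (α t + β i) + 1 / (α t + β (i - 1)))
    + (dtau τ α t) ^ 2 / 4 * (1 / (α t + β i) ^ 2 + 1 / (α t + β (i - 1)) ^ 2)
    + sFun (fun j => α t + β j) i / ((α t + β i) ^ 2 * (α t + β (i + 1)))
    + sFun (fun j => α t + β j) (i - 1) / ((α t + β (i - 1)) ^ 2 * (α t + β (i - 1 - 1)))

/-- The right hand side of the formula for `Δf`, for `a = α + β`, with `d/dτ` derivatives. -/
def laplacianFormula (τ α : ℝ → ℝ) (β : ZMod n → ℝ) (f : Fn n) (t : ℝ) (i : ZMod n) : ℂ :=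
  -dtau τ (dtau τ (fun s => f.1 s i)) t
    + ((1 / (α t + β i) + 1 / (α t + β (i - 1)) : ℝ) : ℂ) *
      (-((dtau τ α t / 2 : ℝ) : ℂ) * dtau τ (fun s => f.1 s i) t + lapZn (f.1 t) i)

end QGeom

end

noncomputable section

namespace QGeom

variable {n : ℕ}

/-! ### Calculus in the algebra of functions -/

/-! The rule `e^b f = R_{deg b}(f) e^b` grades all bimodules by `ℤ_n`. Testing against the indicator
of a single site shows that a coefficient which would shift degree by `k ≠ 0` must vanish. Since `1`
and `2` are nonzero in `ℤ_n` for `n ≥ 3`, an invertible `g` is `c dt ⊗ dt + h e⁺ ⊗ e⁻ + k e⁻ ⊗ e⁺`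
with units `c, h, k` (`IsInverseMetric.eq_diag`), and edge symmetry gives `k = R_-(h)`.

The same test, applied to the difference of the two Leibniz rules on `e^x f = R(f) e^x`, kills most
Christoffel symbols (`IsBimodConn.symbol_eq_zero`). With the prescribed `ℤ_n` part and zero torsion,
only four functions `A, B, C, D` remain. Now `∇g = 0` is a small system (`IsStarQLC.eq_lc`): it
determines the four functions, forces `R_+ c = c`, and makes `cB` both translation invariant and
equal to `∂_t h / 2`. So `∂_t h` does not depend on the site. This is the rigidity behind part (1):
`-h` is its spatial mean `α(t)` plus a frozen `β(i)`, and the real unit `c` has constant sign `ε`,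
hence is `ε` times the square of `dτ/dt`.

Conversely, for real `c` and `h` these two invariances are the only obstructions (`isStarQLC_lc`).
The curvature and the Laplacian follow by inserting the four functions into expansions valid for
arbitrary symbols of this shape. -/

theorem Fn.ext {f g : Fn n} (h : ∀ t i, f.1 t i = g.1 t i) : f = g :=
  Subtype.ext (funext fun t => funext fun i => h t i)

@[simp] theorem Fn.coe_add_apply (f g : Fn n) (t : ℝ) (i : ZMod n) :
    (f + g).1 t i = f.1 t i + g.1 t i := rfl

@[simp] theorem Fn.coe_sub_apply (f g : Fn n) (t : ℝ) (i : ZMod n) :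
    (f - g).1 t i = f.1 t i - g.1 t i := rfl

@[simp] theorem Fn.coe_neg_apply (f : Fn n) (t : ℝ) (i : ZMod n) :
    (-f).1 t i = -f.1 t i := rfl

@[simp] theorem Fn.coe_mul_apply (f g : Fn n) (t : ℝ) (i : ZMod n) :
    (f * g).1 t i = f.1 t i * g.1 t i := rfl

@[simp] theorem Fn.coe_smul_apply (c : ℂ) (f : Fn n) (t : ℝ) (i : ZMod n) :
    (c • f).1 t i = c * f.1 t i := rfl

@[simp] theorem Fn.coe_one_apply (t : ℝ) (i : ZMod n) : (1 : Fn n).1 t i = 1 := rfl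

@[simp] theorem Fn.coe_zero_apply (t : ℝ) (i : ZMod n) : (0 : Fn n).1 t i = 0 := rfl

@[simp] theorem shift_apply (k : ZMod n) (f : Fn n) (t : ℝ) (i : ZMod n) :
    (shift k f).1 t i = f.1 t (i + k) := rfl

@[simp] theorem conj_apply (f : Fn n) (t : ℝ) (i : ZMod n) :
    (conj f).1 t i = star (f.1 t i) := rfl

@[simp] theorem ofTime_apply (u : ℝ → ℝ) (hu : ContDiff ℝ ∞ u) (t : ℝ) (i : ZMod n) :
    (ofTime n u hu).1 t i = u t := rfl

@[simp] theorem ofSpace_apply (b : ZMod n → ℝ) (t : ℝ) (i : ZMod n) :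
    (ofSpace b).1 t i = b i := rfl

theorem Fn.differentiableAt (f : Fn n) (t : ℝ) (i : ZMod n) :
    DifferentiableAt ℝ (fun s => f.1 s i) t :=
  ((f.2 i).differentiable (by simp)).differentiableAt

@[simp] theorem shift_add (k : ZMod n) (f g : Fn n) : shift k (f + g) = shift k f + shift k g := rfl

@[simp] theorem shift_sub (k : ZMod n) (f g : Fn n) : shift k (f - g) = shift k f - shift k g := rfl

@[simp] theorem shift_neg (k : ZMod n) (f : Fn n) : shift k (-f) = -shift k f := rfl

@[simp] theorem shift_mul (k : ZMod n) (f g : Fn n) : shift k (f * g) = shift k f * shift k g := rfl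

@[simp] theorem shift_one (k : ZMod n) : shift k (1 : Fn n) = 1 := rfl

@[simp] theorem shift_zero (k : ZMod n) : shift k (0 : Fn n) = 0 := rfl

@[simp] theorem shift_zero_left (f : Fn n) : shift 0 f = f := by
  apply Fn.ext; simp

@[simp] theorem shift_shift (k l : ZMod n) (f : Fn n) :
    shift k (shift l f) = shift (k + l) f := by
  apply Fn.ext; simp [add_assoc]

@[simp] theorem conj_add (f g : Fn n) : conj (f + g) = conj f + conj g := by
  apply Fn.ext; simp

@[simp] theorem conj_sub (f g : Fn n) : conj (f - g) = conj f - conj g := by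
  apply Fn.ext; simp

@[simp] theorem conj_neg (f : Fn n) : conj (-f) = -conj f := by
  apply Fn.ext; simp

@[simp] theorem conj_mul (f g : Fn n) : conj (f * g) = conj f * conj g := by
  apply Fn.ext; simp

@[simp] theorem conj_one : conj (1 : Fn n) = 1 := by
  apply Fn.ext; simp

@[simp] theorem conj_zero : conj (0 : Fn n) = 0 := by
  apply Fn.ext; simp

theorem conj_half_smul (f : Fn n) : conj ((1 / 2 : ℂ) • f) = (1 / 2 : ℂ) • conj f := by
  apply Fn.ext; simp

@[simp] theorem conj_shift (k : ZMod n) (f : Fn n) : conj (shift k f) = shift k (conj f) := rfl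

@[simp] theorem dtime_add (f g : Fn n) : dtime (f + g) = dtime f + dtime g :=
  Fn.ext fun t i => deriv_fun_add (f.differentiableAt t i) (g.differentiableAt t i)

@[simp] theorem dtime_neg (f : Fn n) : dtime (-f) = -dtime f :=
  Fn.ext fun _ _ => deriv.fun_neg

@[simp] theorem dtime_mul (f g : Fn n) : dtime (f * g) = dtime f * g + f * dtime g :=
  Fn.ext fun t i => deriv_fun_mul (f.differentiableAt t i) (g.differentiableAt t i)

@[simp] theorem dtime_smul (c : ℂ) (f : Fn n) : dtime (c • f) = c • dtime f :=
  Fn.ext fun t i => ((f.differentiableAt t i).hasDerivAt.const_mul c).deriv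

@[simp] theorem dtime_one : dtime (1 : Fn n) = 0 :=
  Fn.ext fun t _ => deriv_const t (1 : ℂ)

@[simp] theorem dtime_zero : dtime (0 : Fn n) = 0 :=
  Fn.ext fun t _ => deriv_const t (0 : ℂ)

@[simp] theorem dtime_shift (k : ZMod n) (f : Fn n) : dtime (shift k f) = shift k (dtime f) := rfl

@[simp] theorem dtime_conj (f : Fn n) : dtime (conj f) = conj (dtime f) := by
  apply Fn.ext
  intro t i
  exact (f.differentiableAt t i).hasDerivAt.star.deriv

/-- A function whose product with all differences `R_k φ - φ` vanishes is zero, for `k ≠ 0`. -/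
theorem eq_zero_of_mul_shift_sub {k : ZMod n} (hk : k ≠ 0) {f : Fn n}
    (h : ∀ φ : Fn n, f * (shift k φ - φ) = 0) : f = 0 := by
  apply Fn.ext
  intro t i
  -- For `φ` the indicator of the site `i`, the difference `R_k φ - φ` equals `-1` at `i`, because
  -- `i + k ≠ i`.
  have := congrArg (fun F : Fn n => F.1 t i) (h (ofSpace fun j => if j = i then 1 else 0))
  simpa [hk] using this

/-! ### Expansion in the basic forms -/

theorem sum_Ix {M : Type*} [AddCommMonoid M] (f : Ix → M) : ∑ x, f x = f .t + f .p + f .m := by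
  change ∑ x ∈ ({.t, .p, .m} : Finset Ix), f x = _
  rw [Finset.sum_insert (by decide), Finset.sum_insert (by decide), Finset.sum_singleton, add_assoc]

theorem Ix.forall {P : Ix → Prop} : (∀ x, P x) ↔ P .t ∧ P .p ∧ P .m :=
  ⟨fun h => ⟨h _, h _, h _⟩, fun h x => by cases x <;> simp [h]⟩

theorem Form1.eq_sum (w : Form1 n) : w = ∑ b, lmul1 (w b) (e b) := by
  funext c
  rw [sum_Ix]
  cases c <;> simp [lmul1, e]

theorem Tens.eq_sum (T : Tens n) : T = ∑ b, ∑ c, lmul2 (T b c) (tmul (e b) (e c)) := by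
  funext b c
  simp only [sum_Ix]
  cases b <;> cases c <;> simp [lmul2, tmul, e]

theorem IsBimodMap.apply_eq_sum {σ : Tens n → Tens n} (h : IsBimodMap σ) (T : Tens n) :
    σ T = ∑ b, ∑ c, lmul2 (T b c) (σ (tmul (e b) (e c))) := by
  let s : Tens n →+ Tens n := AddMonoidHom.mk' σ h.map_add
  have hs : s T = s (∑ b, ∑ c, lmul2 (T b c) (tmul (e b) (e c))) := congrArg s (Tens.eq_sum T)
  simp only [map_sum] at hs
  simpa [s, h.map_smul] using hs

theorem IsBimodMapFn.apply_eq_sum {φ : Tens n → Fn n} (h : IsBimodMapFn φ) (T : Tens n) :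
    φ T = ∑ b, ∑ c, T b c * φ (tmul (e b) (e c)) := by
  let s : Tens n →+ Fn n := AddMonoidHom.mk' φ h.map_add
  have hs : s T = s (∑ b, ∑ c, lmul2 (T b c) (tmul (e b) (e c))) := congrArg s (Tens.eq_sum T)
  simp only [map_sum] at hs
  simpa [s, h.map_smul] using hs

/-- The left connection with Christoffel symbols `∇e^x = ∑ Γ^x_{bc} e^b ⊗ e^c`. -/
def christoffelConn (Γ : Ix → Tens n) (w : Form1 n) : Tens n := fun b c =>
  d0 (w c) b + ∑ x, w x * Γ x b c

theorem d0_add (f g : Fn n) (b : Ix) : d0 (f + g) b = d0 f b + d0 g b := by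
  cases b <;> simp [d0] <;> ring

theorem d0_mul (f g : Fn n) (b : Ix) :
    d0 (f * g) b = d0 f b * shift (deg n b) g + f * d0 g b := by
  cases b <;> simp [d0, deg] <;> ring

theorem d0_zero (b : Ix) : d0 (0 : Fn n) b = 0 := by
  cases b <;> simp [d0]

theorem d0_one (b : Ix) : d0 (1 : Fn n) b = 0 := by
  cases b <;> simp [d0]

theorem christoffelConn_add (Γ : Ix → Tens n) (w η : Form1 n) :
    christoffelConn Γ (w + η) = christoffelConn Γ w + christoffelConn Γ η := by
  funext b c
  simp only [christoffelConn, Pi.add_apply, d0_add, sum_Ix]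
  ring

theorem christoffelConn_lmul (Γ : Ix → Tens n) (f : Fn n) (w : Form1 n) :
    christoffelConn Γ (lmul1 f w) = tmul (d0 f) w + lmul2 f (christoffelConn Γ w) := by
  funext b c
  simp only [christoffelConn, Pi.add_apply, d0_mul, sum_Ix, lmul1, lmul2, tmul]
  ring

theorem christoffelConn_e (Γ : Ix → Tens n) (x : Ix) : christoffelConn Γ (e x) = Γ x := by
  funext b c
  simp only [christoffelConn, sum_Ix, e]
  cases c <;> cases x <;> simp [d0_zero, d0_one]

theorem IsBimodConn.eq_christoffelConn {nabla : Form1 n → Tens n} {σ : Tens n → Tens n}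
    (h : IsBimodConn nabla σ) : nabla = christoffelConn fun x => nabla (e x) := by
  funext w
  let s : Form1 n →+ Tens n := AddMonoidHom.mk' nabla h.map_add
  let s' : Form1 n →+ Tens n :=
    AddMonoidHom.mk' (christoffelConn fun x => nabla (e x)) (christoffelConn_add _)
  change s w = s' w
  rw [Form1.eq_sum w, map_sum, map_sum]
  refine Finset.sum_congr rfl fun b _ => ?_
  simp [s, s', h.left_leibniz, christoffelConn_lmul, christoffelConn_e]

/-! ### The metric and its inverse -/

/-- Moving `f` through `e^b ⊗ e^c` translates it by the total degree, while in the commutative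
algebra `A` it passes through the value of `φ` unchanged. -/
theorem IsBimodMapFn.apply_basis_eq_zero {φ : Tens n → Fn n} (h : IsBimodMapFn φ) {b c : Ix}
    (hbc : deg n b + deg n c ≠ 0) : φ (tmul (e b) (e c)) = 0 := by
  refine eq_zero_of_mul_shift_sub hbc fun f => ?_
  have h1 : rmul2 (tmul (e b) (e c)) f =
      lmul2 (shift (deg n b + deg n c) f) (tmul (e b) (e c)) := by
    funext x y
    cases b <;> cases c <;> cases x <;> cases y <;> simp [rmul2, lmul2, tmul, e]
  have h2 := h.map_rmul (tmul (e b) (e c)) f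
  rw [h1, h.map_smul] at h2
  rw [mul_sub, ← h2]
  ring

theorem two_ne_zero_zmod (hn : 3 ≤ n) : (2 : ZMod n) ≠ 0 := by
  intro h
  have := (ZMod.natCast_eq_zero_iff 2 n).1 (by exact_mod_cast h)
  exact absurd (Nat.le_of_dvd (by norm_num) this) (by omega)

theorem one_ne_zero_zmod (hn : 3 ≤ n) : (1 : ZMod n) ≠ 0 := by
  intro h
  have := (ZMod.natCast_eq_zero_iff 1 n).1 (by exact_mod_cast h)
  exact absurd (Nat.le_of_dvd (by norm_num) this) (by omega)

/-- The tensor `c dt ⊗ dt + h e⁺ ⊗ e⁻ + k e⁻ ⊗ e⁺`. -/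
def diagTens (c h k : Fn n) : Tens n
  | .t, .t => c
  | .p, .m => h
  | .m, .p => k
  | _, _ => 0

/-- The pairing with `(dt, dt) = u`, `(e⁺, e⁻) = v`, `(e⁻, e⁺) = w`, all others zero. -/
def diagPairing (u v w : Fn n) (T : Tens n) : Fn n :=
  T .t .t * u + T .p .m * v + T .m .p * w

theorem isBimodMapFn_diagPairing (u v w : Fn n) : IsBimodMapFn (diagPairing u v w) where
  map_add S T := by simp [diagPairing]; ring
  map_smul f T := by simp [diagPairing, lmul2]; ring
  map_rmul T f := by simp [diagPairing, rmul2, deg]; ring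

theorem IsBimodMapFn.eq_diagPairing (hn : 3 ≤ n) {φ : Tens n → Fn n} (h : IsBimodMapFn φ) :
    φ = diagPairing (φ (tmul (e .t) (e .t))) (φ (tmul (e .p) (e .m)))
      (φ (tmul (e .m) (e .p))) := by
  have h1 := one_ne_zero_zmod hn
  have h2 := two_ne_zero_zmod hn
  have h2' : (1 + 1 : ZMod n) ≠ 0 := by rwa [one_add_one_eq_two]
  have h3 : (-1 + -1 : ZMod n) ≠ 0 := by rwa [← neg_add, neg_ne_zero]
  funext T
  rw [h.apply_eq_sum T]
  simp only [sum_Ix, diagPairing]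
  rw [h.apply_basis_eq_zero (b := .t) (c := .p) (by simpa [deg]),
    h.apply_basis_eq_zero (b := .t) (c := .m) (by simpa [deg]),
    h.apply_basis_eq_zero (b := .p) (c := .t) (by simpa [deg]),
    h.apply_basis_eq_zero (b := .m) (c := .t) (by simpa [deg]),
    h.apply_basis_eq_zero (b := .p) (c := .p) (by simpa [deg] using h2'),
    h.apply_basis_eq_zero (b := .m) (c := .m) (by simpa [deg] using h3)]
  ring

/-- An invertible tensor is `c dt ⊗ dt + h e⁺ ⊗ e⁻ + k e⁻ ⊗ e⁺` with `c, h, k` invertible, and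
its inverse is determined by theirs. -/
theorem IsInverseMetric.eq_diag (hn : 3 ≤ n) {g : Tens n} {ip : Tens n → Fn n}
    (h : IsInverseMetric g ip) :
    g = diagTens (g .t .t) (g .p .m) (g .m .p) ∧ ∃ u v w : Fn n, ip = diagPairing u v w ∧
      g .t .t * u = 1 ∧ shift 1 (g .m .p) * v = 1 ∧ shift (-1) (g .p .m) * w = 1 := by
  have hip := h.bimod.eq_diagPairing hn
  generalize ip (tmul (e .t) (e .t)) = u at hip
  generalize ip (tmul (e .p) (e .m)) = v at hip
  generalize ip (tmul (e .m) (e .p)) = w at hip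
  -- The left inverse property on basic forms gives nine equations. For each `x` one of `u, v, w`
  -- multiplies a (shifted) row of `g`: one product is `1`, so that factor is a unit, and the two
  -- zero products then remove the other entries of the row.
  have key : ∀ x c, ip (tmul (e x) (fun b => g b c)) = e x c := by
    intro x c
    have := congrFun (h.left_inv (e x)) c
    rw [← this, sum_Ix]
    cases c <;> simp [lmul1, e]
  have kt := fun c => key .t c
  have kp := fun c => key .p c
  have km := fun c => key .m c
  simp only [Ix.forall, hip, diagPairing, tmul, e, deg] at kt kp km
  simp at kt kp km
  obtain ⟨a1, a2, a3⟩ := kt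
  obtain ⟨b1, b2, b3⟩ := kp
  obtain ⟨c1, c2, c3⟩ := km
  have canc : ∀ {x y z : Fn n}, x * y = 1 → z * y = 0 → z = 0 := by
    intro x y z h1 h2
    calc z = (z * y) * x := by rw [mul_assoc, mul_comm y, h1, mul_one]
      _ = 0 := by rw [h2, zero_mul]
  have sh : ∀ {k : ZMod n} {z : Fn n}, shift k z = 0 → z = 0 := by
    intro k z hz
    have := congrArg (shift (-k)) hz
    simpa using this
  refine ⟨?_, u, v, w, hip, a1, b2, c3⟩
  funext x y
  cases x <;> cases y <;> simp only [diagTens]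
  · exact canc a1 a2
  · exact canc a1 a3
  · exact sh (canc c3 c1)
  · exact sh (canc c3 c2)
  · exact sh (canc b2 b1)
  · exact sh (canc b2 b3)

theorem isInverseMetric_diagTens {c h k u v w : Fn n} (hu : c * u = 1) (hv : shift 1 k * v = 1)
    (hw : shift (-1) h * w = 1) : IsInverseMetric (diagTens c h k) (diagPairing u v w) where
  bimod := isBimodMapFn_diagPairing u v w
  left_inv η := by
    funext x
    rw [sum_Ix]
    cases x <;> simp [lmul1, e, diagPairing, diagTens, tmul, deg, mul_assoc, hu, hv, hw]
  right_inv η := by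
    have hv' : k * shift (-1) v = 1 := by simpa using congrArg (shift (-1)) hv
    have hw' : h * shift 1 w = 1 := by simpa using congrArg (shift 1) hw
    funext x
    rw [sum_Ix]
    cases x <;> simp [rmul1, e, diagPairing, diagTens, tmul, deg]
    · rw [mul_left_comm, hu, mul_one]
    · rw [mul_left_comm, hw', mul_one]
    · rw [mul_left_comm, hv', mul_one]

/-! ### The connection over the standard one on `ℤ_n` -/

/-- The constant `1/2`. -/
def half (n : ℕ) : Fn n := algebraMap ℂ (Fn n) (1 / 2)

theorem half_smul (f : Fn n) : (1 / 2 : ℂ) • f = half n * f := rfl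

theorem two_mul_half : 2 * half n = 1 := by
  rw [two_mul]
  apply Fn.ext
  intro t i
  change (1 / 2 : ℂ) + 1 / 2 = 1
  norm_num

@[simp] theorem shift_half (k : ZMod n) : shift k (half n) = half n := rfl

@[simp] theorem dtime_half : dtime (half n) = 0 := by
  have := dtime_smul (1 / 2) (1 : Fn n)
  rwa [half_smul, mul_one, dtime_one, smul_zero] at this

@[simp] theorem conj_half : conj (half n) = half n := by
  have := conj_half_smul (1 : Fn n)
  rwa [half_smul, mul_one, conj_one, half_smul, mul_one] at this

/-- The braiding which is a flip up to the factors `ρ` on `e⁺ ⊗ e⁺` and `κ` on `e⁻ ⊗ e⁻`. -/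
def diagBraid (ρ κ : Fn n) (T : Tens n) : Tens n
  | .p, .p => ρ * T .p .p
  | .m, .m => κ * T .m .m
  | b, c => T c b

/-- Christoffel symbols of the shape allowed over the standard connection on `ℤ_n`. -/
def diagSymbols (A B C D P M : Fn n) : Ix → Tens n
  | .t, .t, .t => A
  | .t, .p, .m => B
  | .t, .m, .p => B
  | .p, .t, .p => C
  | .p, .p, .t => C
  | .p, .p, .p => P
  | .m, .t, .m => D
  | .m, .m, .t => D
  | .m, .m, .m => M
  | _, _, _ => 0

/-- The function `ρ = R_+(h) / h`, where `hi` is the inverse of `h`. -/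
def rho (h hi : Fn n) : Fn n := shift 1 h * hi

/-- The function `R_-²(ρ⁻¹)`, where `hi` is the inverse of `h`. -/
def kappa (h hi : Fn n) : Fn n := shift (-2) h * shift (-1) hi

/-- The Christoffel symbols of the Levi-Civita connection of `c dt ⊗ dt + h e⁺ ⊗ e⁻ + R_-(h) e⁻ ⊗ e⁺`,
where `ci` and `hi` are the inverses of `c` and `h`. -/
def lcSymbols (c ci h hi : Fn n) : Ix → Tens n :=
  diagSymbols (-(half n * ci * dtime c)) (half n * ci * dtime h) (-(half n * hi * dtime h))
    (-(half n * shift (-1) hi * shift (-1) (dtime h))) (1 - rho h hi) (1 - kappa h hi)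

theorem isBimodMap_diagBraid (ρ κ : Fn n) : IsBimodMap (diagBraid ρ κ) where
  map_add S T := by
    funext b c
    cases b <;> cases c <;> simp [diagBraid, mul_add]
  map_smul f T := by
    funext b c
    cases b <;> cases c <;> simp [diagBraid, lmul2, mul_left_comm]
  map_rmul T f := by
    funext b c
    cases b <;> cases c <;> simp [diagBraid, rmul2, deg, mul_assoc]

theorem IsBimodMap.eq_diagBraid {σ : Tens n → Tens n} (hσ : IsBimodMap σ) {ρ κ : Fn n}
    (fl : ∀ b, σ (tmul (e .t) (e b)) = tmul (e b) (e .t))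
    (fr : ∀ b, σ (tmul (e b) (e .t)) = tmul (e .t) (e b))
    (hpp : σ (tmul (e .p) (e .p)) = lmul2 ρ (tmul (e .p) (e .p)))
    (hpm : σ (tmul (e .p) (e .m)) = tmul (e .m) (e .p))
    (hmp : σ (tmul (e .m) (e .p)) = tmul (e .p) (e .m))
    (hmm : σ (tmul (e .m) (e .m)) = lmul2 κ (tmul (e .m) (e .m))) : σ = diagBraid ρ κ := by
  funext T b c
  rw [hσ.apply_eq_sum T]
  simp only [sum_Ix, fl, fr, hpp, hpm, hmp, hmm]
  cases b <;> cases c <;> simp [lmul2, tmul, e, diagBraid, mul_comm]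

/-- Expanding `∇(e^x f) = ∇(R(f) e^x)` by the right and by the left Leibniz rule, the derivative
terms cancel in the component `b, c` under the assumption on `σ`. What is left is the symbol times a
difference of two translates of `f`. -/
theorem IsBimodConn.symbol_eq_zero {nabla : Form1 n → Tens n} {σ : Tens n → Tens n}
    (H : IsBimodConn nabla σ) {x b c : Ix} (hd : deg n b + deg n c - deg n x ≠ 0)
    (hσ : ∀ f : Fn n, σ (tmul (e x) (d0 f)) b c = tmul (d0 (shift (deg n x) f)) (e x) b c) :
    nabla (e x) b c = 0 := by
  refine eq_zero_of_mul_shift_sub hd fun φ => ?_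
  have h1 := H.right_leibniz (e x) (shift (-deg n x) φ)
  have h2 : rmul1 (e x) (shift (-deg n x) φ) = lmul1 φ (e x) := by
    funext y
    cases x <;> cases y <;> simp [rmul1, lmul1, e, deg]
  rw [h2, H.left_leibniz] at h1
  have h3 := congrFun (congrFun h1 b) c
  simp only [Pi.add_apply, hσ, shift_shift, add_neg_cancel, shift_zero_left] at h3
  simp only [lmul2, rmul2, shift_shift, ← sub_eq_add_neg] at h3
  linear_combination -h3

theorem d1_e (x : Ix) : d1 (e x : Form1 n) = 0 := by
  have : ∀ b, d0 (e x b : Fn n) = 0 := by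
    intro b
    funext y
    by_cases hb : b = x <;> simp [e, hb, d0_zero, d0_one]
  funext q
  simp only [d1, this, sum_Ix, Pi.add_apply, Pi.zero_apply]
  cases q <;> simp [wedge, tmul]

/-- Uniqueness and the obstruction come from the same linear system, so both are extracted together.
-/
theorem IsStarQLC.eq_lc (hn : 3 ≤ n) {c ci h hi : Fn n} (hc : c * ci = 1) (hh : h * hi = 1)
    {nabla : Form1 n → Tens n} {σ : Tens n → Tens n}
    (H : IsStarQLC (diagTens c h (shift (-1) h)) nabla σ)
    (E : ExtendsZn (diagTens c h (shift (-1) h)) nabla σ) :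
    nabla = christoffelConn (lcSymbols c ci h hi) ∧ σ = diagBraid (rho h hi) (kappa h hi) ∧
      shift 1 c = c ∧ shift 1 (dtime h) = dtime h := by
  obtain ⟨ρ, κ, hρ, hκ, hpp, hpm, hmp, hmm, hp, hm⟩ := E.zn_part
  simp only [diagTens] at hρ
  have hρ' : ρ = rho h hi := by
    unfold rho
    linear_combination hi * hρ - ρ * hh
  have hhs : ∀ k, shift k h * shift k hi = 1 := fun k => by rw [← shift_mul, hh, shift_one]
  have hκ' : κ = kappa h hi := by
    rw [hρ', rho] at hκ
    have e1 : (-2 + 1 : ZMod n) = -1 := by norm_num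
    simp only [shift_mul, shift_shift, e1] at hκ
    unfold kappa
    linear_combination (shift (-2) h * shift (-1) hi) * hκ -
      κ * shift (-2) h * shift (-2) hi * hhs (-1) - κ * hhs (-2)
  have hσ := H.conn.braiding.eq_diagBraid E.flip_left E.flip_right hpp hpm hmp hmm
  have z1 := one_ne_zero_zmod hn
  have z2 := two_ne_zero_zmod hn
  have z2' : (1 + 1 : ZMod n) ≠ 0 := by rwa [one_add_one_eq_two]
  have z3 : (-1 + -1 : ZMod n) ≠ 0 := by rwa [← neg_add, neg_ne_zero]
  have z4 : (-1 - 1 : ZMod n) ≠ 0 := by rwa [sub_eq_add_neg]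
  have van := fun x b c => H.conn.symbol_eq_zero (x := x) (b := b) (c := c)
  rw [hσ] at van
  have t_tp := van .t .t .p (by simpa [deg]) (fun f => by simp [diagBraid, tmul, e, deg])
  have t_tm := van .t .t .m (by simpa [deg]) (fun f => by simp [diagBraid, tmul, e, deg])
  have t_pt := van .t .p .t (by simpa [deg]) (fun f => by simp [diagBraid, tmul, e, deg])
  have t_mt := van .t .m .t (by simpa [deg]) (fun f => by simp [diagBraid, tmul, e, deg])
  have t_pp := van .t .p .p (by simpa [deg] using z2') (fun f => by simp [diagBraid, tmul, e, deg])
  have t_mm := van .t .m .m (by simpa [deg] using z3) (fun f => by simp [diagBraid, tmul, e, deg])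
  have p_tt := van .p .t .t (by simpa [deg]) (fun f => by simp [diagBraid, tmul, e, deg])
  have p_tm := van .p .t .m (by simpa [deg] using z4) (fun f => by simp [diagBraid, tmul, e, deg])
  have p_mt := van .p .m .t (by simpa [deg] using z4) (fun f => by simp [diagBraid, tmul, e, deg])
  have m_tt := van .m .t .t (by simpa [deg]) (fun f => by simp [diagBraid, tmul, e, deg])
  have m_tp := van .m .t .p (by simpa [deg] using z2') (fun f => by simp [diagBraid, tmul, e, deg])
  have m_pt := van .m .p .t (by simpa [deg] using z2') (fun f => by simp [diagBraid, tmul, e, deg])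
  simp only [Ix.forall] at hp hm
  simp [lmul2, tmul, e] at hp hm
  obtain ⟨⟨p_pp, p_pm⟩, p_mp, p_mm⟩ := hp
  obtain ⟨⟨m_pp, m_pm⟩, m_mp, m_mm⟩ := hm
  -- Torsion freeness identifies the surviving symbols in pairs, leaving one unknown for each of
  -- `B`, `C`, `D`, besides `A`.
  have tor := fun x => H.torsion_free (e x)
  simp only [d1_e] at tor
  have tor_t := congrFun (tor .t) .pm
  have tor_p := congrFun (tor .p) .tp
  have tor_m := congrFun (tor .m) .tm
  simp only [wedge, Pi.zero_apply, sub_eq_zero] at tor_t tor_p tor_m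
  obtain ⟨A, hA⟩ : ∃ A, nabla (e .t) .t .t = A := ⟨_, rfl⟩
  obtain ⟨B, hB⟩ : ∃ B, nabla (e .t) .p .m = B := ⟨_, rfl⟩
  obtain ⟨C, hC⟩ : ∃ C, nabla (e .p) .t .p = C := ⟨_, rfl⟩
  obtain ⟨D, hD⟩ : ∃ D, nabla (e .m) .t .m = D := ⟨_, rfl⟩
  rw [hB] at tor_t
  rw [hC] at tor_p
  rw [hD] at tor_m
  have hΓ : (fun x => nabla (e x)) = diagSymbols A B C D (1 - ρ) (1 - κ) := by
    funext x b c
    cases x <;> cases b <;> cases c <;> simp only [diagSymbols] <;> first | assumption | (symm; assumption)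
  have hnab := H.conn.eq_christoffelConn
  rw [hΓ] at hnab
  have mc := H.metric_compat
  unfold nablaMetric at mc
  have hΓ' : ∀ x b c, nabla (e x) b c = diagSymbols A B C D (1 - ρ) (1 - κ) x b c := fun x b c =>
    congrFun (congrFun (congrFun hΓ x) b) c
  simp only [hΓ', hσ, sum_Ix] at mc
  rw [hnab] at mc
  simp only [christoffelConn, sum_Ix] at mc
  -- These components suffice. `m2` is `R_+ c = c`; `m3`, `m4`, `m6`, `m8` equate `-cB` to
  -- `R_-(hC)`, `h R_+(D)`, `R_-(h) D`, `hC` respectively; `m1`, `m5`, `m7` contain the time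
  -- derivatives.
  have m1 := mc .t .t .t
  have m2 := mc .p .t .t
  have m3 := mc .p .m .t
  have m4 := mc .m .p .t
  have m5 := mc .t .m .p
  have m6 := mc .m .t .p
  have m7 := mc .t .p .m
  have m8 := mc .p .t .m
  clear mc
  simp only [diagBraid] at m1 m2 m3 m4 m5 m6 m7 m8
  simp [tmul, diagSymbols, diagTens, deg, d0] at m1 m2 m3 m4 m5 m6 m7 m8
  have hcs : shift 1 c = c := sub_eq_zero.1 m2
  have hh' := hhs (-1)
  -- `m8` translated by `-1` and `m3` share the term `R_-(hC)`, so `cB` equals its own translate.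
  have hBs : shift 1 B = B := by
    have h1 : c * B = shift (-1) c * shift (-1) B := by
      have := congrArg (shift (-1)) m8
      simp only [shift_add, shift_mul, shift_zero] at this
      linear_combination m3 - this
    have h2 : c * shift 1 B = c * B := by
      have := congrArg (shift 1) h1
      simpa [hcs] using this
    linear_combination ci * h2 - (shift 1 B - B) * hc
  have hdh : dtime h = 2 * (c * B) := by
    linear_combination m7 - m8 - m4
  have hhalf := two_mul_half (n := n)
  refine ⟨?_, by rw [hσ, hρ', hκ'], hcs, ?_⟩
  · have eA : A = -(half n * ci * dtime c) := by
      linear_combination half n * ci * m1 - A * (2 * half n) * hc - A * hhalf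
    have eB : B = half n * ci * dtime h := by
      linear_combination -half n * ci * hdh - B * (2 * half n) * hc - B * hhalf
    have eC : C = -(half n * hi * dtime h) := by
      linear_combination half n * hi * hdh + hi * m8 - C * hh + hi * c * B * hhalf
    have hdh' : shift (-1) (dtime h) = 2 * (c * B) := by
      linear_combination m5 - m6 - m3
    have eD : D = -(half n * shift (-1) hi * shift (-1) (dtime h)) := by
      linear_combination half n * shift (-1) hi * hdh' + shift (-1) hi * m6 - D * hh' +
        shift (-1) hi * c * B * hhalf
    rw [hnab, eA, eB, eC, eD, hρ', hκ']
    rfl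
  · rw [hdh, two_mul, shift_add, shift_mul, hcs, hBs]

theorem conj_inv_eq {f fi : Fn n} (h : f * fi = 1) (hf : conj f = f) : conj fi = fi := by
  have := congrArg conj h
  rw [conj_mul, hf, conj_one] at this
  linear_combination fi * this - conj fi * h

/-- `1` generates `ℤ_n`. -/
theorem shift_eq_of_shift_one {f : Fn n} (h : shift 1 f = f) (k : ZMod n) : shift k f = f := by
  obtain ⟨z, rfl⟩ := ZMod.intCast_surjective k
  have hneg : shift (-1) f = f := by
    conv_lhs => rw [← h]
    simp
  induction z using Int.induction_on with
  | zero => simp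
  | succ z ih =>
    push_cast at ih ⊢
    rw [← shift_shift, h, ih]
  | pred z ih =>
    push_cast at ih ⊢
    rw [sub_eq_add_neg, ← shift_shift, hneg, ih]

theorem extendsZn_lc {c ci h hi : Fn n} (hh : h * hi = 1) :
    ExtendsZn (diagTens c h (shift (-1) h)) (christoffelConn (lcSymbols c ci h hi))
      (diagBraid (rho h hi) (kappa h hi)) where
  flip_left x := by
    funext b c
    cases x <;> cases b <;> cases c <;> simp [diagBraid, tmul, e]
  flip_right x := by
    funext b c
    cases x <;> cases b <;> cases c <;> simp [diagBraid, tmul, e]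
  zn_part := by
    have hhs : ∀ k, shift k h * shift k hi = 1 := fun k => by rw [← shift_mul, hh, shift_one]
    refine ⟨rho h hi, kappa h hi, ?_, ?_, ?_, ?_, ?_, ?_, ?_, ?_⟩
    · simp only [diagTens, rho]
      linear_combination shift 1 h * hh
    · have e1 : (-2 + 1 : ZMod n) = -1 := by norm_num
      simp only [kappa, rho, shift_mul, shift_shift, e1]
      linear_combination shift (-1) h * shift (-1) hi * hhs (-2) + hhs (-1)
    · funext b c
      cases b <;> cases c <;> simp [diagBraid, tmul, e, lmul2]
    · funext b c
      cases b <;> cases c <;> simp [diagBraid, tmul, e]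
    · funext b c
      cases b <;> cases c <;> simp [diagBraid, tmul, e]
    · funext b c
      cases b <;> cases c <;> simp [diagBraid, tmul, e, lmul2]
    · intro b c hb hc
      rw [christoffelConn_e]
      cases b <;> cases c <;> simp [lcSymbols, diagSymbols, tmul, e, lmul2] at hb hc ⊢
    · intro b c hb hc
      rw [christoffelConn_e]
      cases b <;> cases c <;> simp [lcSymbols, diagSymbols, tmul, e, lmul2] at hb hc ⊢

/-- On `e⁺ ⊗ e⁺` the right Leibniz rule balances exactly because the symbol is `1 - ρ` when the
braiding factor is `ρ`; likewise for `κ` on `e⁻ ⊗ e⁻`. The functions `A, B, C, D` are unconstrained.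
-/
theorem isBimodConn_diagSymbols {A B C D ρ κ : Fn n} :
    IsBimodConn (christoffelConn (diagSymbols A B C D (1 - ρ) (1 - κ))) (diagBraid ρ κ) where
  braiding := isBimodMap_diagBraid _ _
  map_add := christoffelConn_add _
  left_leibniz := christoffelConn_lmul _
  right_leibniz w f := by
    funext b c
    simp only [Pi.add_apply, rmul2, christoffelConn, rmul1, d0_mul, sum_Ix]
    cases b <;> cases c <;> simp only [diagBraid] <;> simp [diagSymbols, tmul, d0, deg] <;> ring

theorem wedge_christoffelConn_diagSymbols {A B C D P M : Fn n} (w : Form1 n) :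
    wedge (christoffelConn (diagSymbols A B C D P M) w) = d1 w := by
  funext q
  simp only [d1, Finset.sum_apply, sum_Ix]
  cases q <;> simp only [wedge, christoffelConn, sum_Ix] <;>
    simp [diagSymbols, tmul, e] <;> ring

/-- The invariances of `c` and `∂_t h` found necessary in `IsStarQLC.eq_lc` are also sufficient once
`c` and `h` are real. -/
theorem isStarQLC_lc {c ci h hi : Fn n} (hc : c * ci = 1) (hh : h * hi = 1)
    (hcc : conj c = c) (hhc : conj h = h) (hcs : shift 1 c = c)
    (hhs : shift 1 (dtime h) = dtime h) :
    IsStarQLC (diagTens c h (shift (-1) h)) (christoffelConn (lcSymbols c ci h hi))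
      (diagBraid (rho h hi) (kappa h hi)) where
  conn := isBimodConn_diagSymbols
  torsion_free := wedge_christoffelConn_diagSymbols
  metric_compat := by
    have hS := shift_eq_of_shift_one hcs
    have hT := shift_eq_of_shift_one hhs
    have hih : ∀ k, shift k h * shift k hi = 1 := fun k => by rw [← shift_mul, hh, shift_one]
    have e1 : (1 + -2 : ZMod n) = -1 := by norm_num
    have e2 : (-1 + -1 : ZMod n) = -2 := by norm_num
    have hhalf := two_mul_half (n := n)
    unfold nablaMetric
    intro b c x
    simp only [christoffelConn_e]
    simp only [christoffelConn, sum_Ix]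
    cases b <;> cases c <;> cases x <;> simp only [diagBraid] <;>
      simp [tmul, diagTens, lcSymbols, diagSymbols, deg, d0, hS, hT, rho, kappa]
    · linear_combination -dtime c * (2 * half n) * hc - dtime c * hhalf
    · linear_combination -dtime h * (2 * half n) * hh - dtime h * hhalf
    · linear_combination -dtime h * (2 * half n) * hih (-1) - dtime h * hhalf
    · linear_combination half n * dtime h * (hc - hh)
    · linear_combination -shift 1 h * hh
    · linear_combination half n * dtime h * (hc - hih (-1))
    · linear_combination -h * hih (-1)
    · linear_combination half n * dtime h * (hc - hih (-1))
    · linear_combination half n * dtime h * (hc - hh)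
    · rw [e1]
      linear_combination -shift (-1) h * hh
    · rw [e2]
      linear_combination -shift (-2) h * hih (-1)
  star_preserving w := by
    have hci := conj_inv_eq hc hcc
    have hhi := conj_inv_eq hh hhc
    have hT := shift_eq_of_shift_one hhs
    have hih : ∀ k, shift k h * shift k hi = 1 := fun k => by rw [← shift_mul, hh, shift_one]
    -- `†` exchanges the `e⁺ ⊗ e⁺` and `e⁻ ⊗ e⁻` coefficients up to translation by two sites, and
    -- `σ` then multiplies by `ρ` or `κ`. Reality of `h` makes these factors inverse to each other
    -- after that translation.
    have hρκ : rho h hi * shift (1 + 1) (conj (kappa h hi)) = 1 := by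
      have e1 : (1 + 1 + -2 : ZMod n) = 0 := by norm_num
      simp only [rho, kappa, conj_mul, conj_shift, hhc, hhi, shift_mul, shift_shift, e1,
        add_neg_cancel_right, shift_zero_left]
      linear_combination shift 1 h * shift 1 hi * hh + hih 1
    have hκρ : kappa h hi * shift (-1 + -1) (conj (rho h hi)) = 1 := by
      have e1 : (-2 + 1 : ZMod n) = -1 := by norm_num
      have e2 : (-1 + -1 : ZMod n) = -2 := by norm_num
      simp only [rho, kappa, conj_mul, conj_shift, hhc, hhi, shift_mul, shift_shift, e1, e2]
      linear_combination shift (-1) h * shift (-1) hi * hih (-2) + hih (-1)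
    funext b c
    cases b <;> cases c <;> simp only [diagBraid, dagger, christoffelConn, sum_Ix] <;>
      simp [star1, diagSymbols, lcSymbols, deg, d0, sgn, opp, hT, hcc, hhc, hhi, hci, ← dtime_conj]
    · ring
    · ring
    · ring
    · linear_combination shift (1 + 1) (conj (w .m)) * hρκ
    · ring
    · ring
    · ring
    · linear_combination shift (-1 + -1) (conj (w .p)) * hκρ

/-! ### Curvature and Laplacian -/

/-- No relation between symbols and metric is used here, which keeps the expansion polynomial; the
Levi-Civita values are inserted afterwards. -/
theorem scalarCurv_diagSymbols {c h k u v w A B C D P M : Fn n} :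
    scalarCurv (diagTens c h k) (diagPairing u v w)
        (christoffelConn (diagSymbols A B C D P M)) =
      half n * (-(k * w * u * shift (-1) (dtime C - (C * C - C * shift 1 A)))
        - h * v * u * shift 1 (dtime D - (D * D - D * shift (-1) A))
        + (c * u * (dtime B - (A * B - B * shift 1 D))
          - h * v * (shift 1 D * B + (shift 2 M - shift 1 M))) * v
        + (c * u * (dtime B - (A * B - B * shift (-1) C))
          + k * w * (shift (-1) P - shift (-2) P - shift (-1) C * B)) * w) := by
  have e1 : (-1 + -1 : ZMod n) = -2 := by norm_num
  have e2 : (1 + 1 : ZMod n) = 2 := by norm_num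
  unfold scalarCurv
  simp only [diagPairing]
  simp only [ricci, sum_Ix]
  simp only [diagPairing, tmul, lift2, riemann, half_smul]
  simp [diagTens, deg, christoffelConn_e, d1, sum_Ix, wedge]
  simp [tmul, e, deg, d0, diagSymbols, e1, e2]
  ring

theorem laplacian_diagSymbols {u v w A B C D P M : Fn n} (f : Fn n) :
    laplacian (diagPairing u v w) (christoffelConn (diagSymbols A B C D P M)) f =
      (dtime (dtime f) + dtime f * A) * u + (dtime f * B - (shift 1 f + shift (-1) f - (f + f))) * v
        + (dtime f * B - (shift 1 f + shift (-1) f - (f + f))) * w := by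
  simp only [laplacian, diagPairing, christoffelConn, sum_Ix]
  simp [d0, diagSymbols]
  ring

theorem dtime_inv {f fi : Fn n} (h : f * fi = 1) : dtime fi = -(fi * fi * dtime f) := by
  have := congrArg dtime h
  rw [dtime_mul, dtime_one] at this
  linear_combination fi * this - dtime fi * h

theorem eq_inv_apply {f fi : Fn n} (h : f * fi = 1) (t : ℝ) (i : ZMod n) :
    f.1 t i ≠ 0 ∧ fi.1 t i = (f.1 t i)⁻¹ := by
  have h1 : f.1 t i * fi.1 t i = 1 := congrArg (fun F : Fn n => F.1 t i) h
  exact ⟨left_ne_zero_of_mul_eq_one h1, eq_inv_of_mul_eq_one_right h1⟩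

theorem half_apply (t : ℝ) (i : ZMod n) : (half n).1 t i = 1 / 2 := rfl

/-! ### Scalar curvature and Laplacian for `c = -p²`, `h = -a` -/

section Lorentzian

variable {p q a b : Fn n}

theorem two_scalarCurv_lc (hpq : p * q = 1) (hab : a * b = 1) (hp : shift 1 p = p)
    (ha : shift 1 (dtime a) = dtime a) :
    2 * scalarCurv (diagTens (-(p * p)) (-a) (shift (-1) (-a)))
        (diagPairing (-(q * q)) (-b) (shift (-1) (-b)))
        (christoffelConn (lcSymbols (-(p * p)) (-(q * q)) (-a) (-b))) =
      -(q * dtime (q * dtime a)) * (b + shift (-1) b)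
        + half n * half n * (q * dtime a) * (q * dtime a) * (b * b + shift (-1) (b * b))
        + (shift 1 a * shift (-1) a - a * a) * (b * b * shift 1 b)
        + (a * shift (-2) a - shift (-1) (a * a)) * (shift (-1) (b * b) * shift (-2) b) := by
  have hpk := shift_eq_of_shift_one hp
  have hqk : ∀ k, shift k q = q := fun k => by
    have h1 : p * shift k q = 1 := by rw [← hpk k, ← shift_mul, hpq, shift_one]
    linear_combination q * h1 - shift k q * hpq
  have hak := shift_eq_of_shift_one ha
  have hdpk : ∀ k, shift k (dtime p) = dtime p := fun k => by rw [← dtime_shift, hpk]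
  have hddak : ∀ k, shift k (dtime (dtime a)) = dtime (dtime a) := fun k => by
    rw [← dtime_shift, hak]
  have e2 : (1 + -2 : ZMod n) = -1 := by norm_num
  have e3 : (2 + -2 : ZMod n) = 0 := by norm_num
  have e4 : (2 + -1 : ZMod n) = 1 := by norm_num
  have e5 : (-2 + 1 : ZMod n) = -1 := by norm_num
  rw [lcSymbols, scalarCurv_diagSymbols]
  simp only [rho, kappa, shift_mul, shift_neg, shift_sub, shift_add, dtime_mul, dtime_neg,
    dtime_half, shift_half, dtime_inv hpq, dtime_inv hab, hpk, hqk, hak, hdpk, hddak, shift_shift,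
    dtime_shift, e2, e3, e4, e5, shift_zero_left, shift_one, neg_add_cancel, add_neg_cancel]
  -- Evaluated at a point, the identity is one between rational functions of `a` at the sites `i-2,
  -- …, i+1`, of `p`, and of time derivatives common to all sites.
  apply Fn.ext
  intro t i
  obtain ⟨p0, q0⟩ := eq_inv_apply hpq t i
  obtain ⟨a0, b0⟩ := eq_inv_apply hab t i
  obtain ⟨a1, b1⟩ := eq_inv_apply hab t (i + 1)
  obtain ⟨a2, b2⟩ := eq_inv_apply hab t (i + -1)
  obtain ⟨a3, b3⟩ := eq_inv_apply hab t (i + -2)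
  rw [two_mul]
  simp only [Fn.coe_add_apply, Fn.coe_sub_apply, Fn.coe_neg_apply, Fn.coe_mul_apply, shift_apply,
    Fn.coe_zero_apply, Fn.coe_one_apply, half_apply, q0, b0, b1, b2, b3]
  generalize p.1 t i = P at *
  generalize a.1 t i = A at *
  generalize a.1 t (i + 1) = A1 at *
  generalize a.1 t (i + -1) = A2 at *
  generalize a.1 t (i + -2) = A3 at *
  generalize (dtime a).1 t i = dA at *
  generalize (dtime p).1 t i = dP at *
  generalize (dtime (dtime a)).1 t i = ddA at *
  clear * - p0 a0 a1 a2 a3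
  field_simp
  ring

theorem laplacian_lc (hpq : p * q = 1) (f : Fn n) :
    laplacian (diagPairing (-(q * q)) (-b) (shift (-1) (-b)))
        (christoffelConn (lcSymbols (-(p * p)) (-(q * q)) (-a) (-b))) f =
      -(q * dtime (q * dtime f)) + (b + shift (-1) b) *
        (-(half n * (q * dtime a)) * (q * dtime f) + (shift 1 f + shift (-1) f - (f + f))) := by
  have hhalf := two_mul_half (n := n)
  rw [lcSymbols, laplacian_diagSymbols]
  simp only [shift_neg, dtime_mul, dtime_neg, dtime_inv hpq]
  apply Fn.ext
  intro t i
  obtain ⟨p0, q0⟩ := eq_inv_apply hpq t i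
  simp only [Fn.coe_add_apply, Fn.coe_sub_apply, Fn.coe_neg_apply, Fn.coe_mul_apply, half_apply, q0]
  field_simp
  ring

end Lorentzian

/-! ### Block diagonal metrics -/

theorem dtime_ofTime {u : ℝ → ℝ} (hu : ContDiff ℝ ∞ u) :
    dtime (ofTime n u hu) = ofTime n (deriv u) (contDiff_infty_iff_deriv.1 hu).2 :=
  Fn.ext fun t _ => ((hu.differentiable (by simp)).differentiableAt (x := t)).hasDerivAt.ofReal_comp.deriv

@[simp] theorem dtime_ofSpace (b : ZMod n → ℝ) : dtime (ofSpace b) = 0 :=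
  Fn.ext fun t i => deriv_const t (b i : ℂ)

@[simp] theorem shift_ofTime (k : ZMod n) {u : ℝ → ℝ} (hu : ContDiff ℝ ∞ u) :
    shift k (ofTime n u hu) = ofTime n u hu := rfl

@[simp] theorem conj_ofTime {u : ℝ → ℝ} (hu : ContDiff ℝ ∞ u) :
    conj (ofTime n u hu) = ofTime n u hu :=
  Fn.ext fun t _ => Complex.conj_ofReal (u t)

@[simp] theorem conj_ofSpace (b : ZMod n → ℝ) : conj (ofSpace b) = ofSpace b :=
  Fn.ext fun _ i => Complex.conj_ofReal (b i)

theorem blockMetric_ofTime (ε : ℂ) {τ : ℝ → ℝ} (hτ : ContDiff ℝ ∞ τ) (a : Fn n) :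
    blockMetric ε (ofTime n τ hτ) a =
      diagTens (ε • (dtime (ofTime n τ hτ) * dtime (ofTime n τ hτ))) (-a) (shift (-1) (-a)) := by
  rw [Algebra.smul_def]
  funext b c
  cases b <;> cases c <;>
    simp [blockMetric, diagTens, lmul2, tmul, d0, e, deg]

theorem dagger_diagTens_eq_iff {c h : Fn n} :
    dagger (diagTens c h (shift (-1) h)) = diagTens c h (shift (-1) h) ↔ conj c = c ∧ conj h = h := by
  constructor
  · intro H
    have h1 := congrFun (congrFun H .t) .t
    have h2 := congrFun (congrFun H .p) .m
    simp only [dagger, diagTens, sgn, opp, deg, add_zero, add_neg_cancel, shift_zero_left, one_mul] at h1 h2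
    exact ⟨h1, by linear_combination h2⟩
  · rintro ⟨h1, h2⟩
    funext b c
    cases b <;> cases c <;> simp [dagger, diagTens, sgn, opp, deg, h1, h2] <;> ring

/-- By the intermediate value theorem `c` has constant sign `ε`; `τ` is a primitive of `√(ε c)`,
smooth because `ε c` stays positive. -/
theorem exists_sign_and_time {c : ℝ → ℝ} (hc : ContDiff ℝ ∞ c) (h0 : ∀ t, c t ≠ 0) :
    ∃ (ε : ℝ) (τ : ℝ → ℝ), ContDiff ℝ ∞ τ ∧ (ε = 1 ∨ ε = -1) ∧ (∀ t, 0 < deriv τ t) ∧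
      ∀ t, c t = ε * (deriv τ t * deriv τ t) := by
  have hsign : ∃ ε : ℝ, (ε = 1 ∨ ε = -1) ∧ ∀ t, 0 < ε * c t := by
    have hpos : (∀ t, 0 < c t) ∨ ∀ t, c t < 0 := by
      by_contra! hcon
      obtain ⟨⟨x, hx⟩, y, hy⟩ := hcon
      obtain ⟨z, hz⟩ := mem_range_of_exists_le_of_exists_ge hc.continuous ⟨x, hx⟩ ⟨y, hy⟩
      exact h0 z hz
    rcases hpos with h | h
    · exact ⟨1, Or.inl rfl, fun t => by simpa using h t⟩
    · exact ⟨-1, Or.inr rfl, fun t => by simpa using h t⟩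
  obtain ⟨ε, hε, hpos⟩ := hsign
  have hsq : ContDiff ℝ ∞ fun t => √(ε * c t) :=
    (contDiff_const.mul hc).sqrt fun t => (hpos t).ne'
  have hder : ∀ t, HasDerivAt (fun t => ∫ s in (0 : ℝ)..t, √(ε * c s)) (√(ε * c t)) t := fun t =>
    hsq.continuous.integral_hasStrictDerivAt 0 t |>.hasDerivAt
  have hderiv : deriv (fun t => ∫ s in (0 : ℝ)..t, √(ε * c s)) = fun t => √(ε * c t) :=
    funext fun t => (hder t).deriv
  refine ⟨ε, fun t => ∫ s in (0 : ℝ)..t, √(ε * c s), ?_, hε, ?_, ?_⟩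
  · rw [contDiff_infty_iff_deriv, hderiv]
    exact ⟨fun t => (hder t).differentiableAt, hsq⟩
  · intro t
    rw [hderiv]
    exact Real.sqrt_pos.2 (hpos t)
  · intro t
    rw [hderiv]
    change c t = ε * (√(ε * c t) * √(ε * c t))
    rw [Real.mul_self_sqrt (hpos t).le]
    rcases hε with h | h <;> rw [h] <;> ring

/-- A family of functions with equal derivatives is a function of time plus constants of zero sum. -/
theorem exists_splitting [NeZero n] {a : ZMod n → ℝ → ℝ} (ha : ∀ i, ContDiff ℝ ∞ (a i))
    (hd : ∀ i j t, deriv (a i) t = deriv (a j) t) :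
    ∃ (α : ℝ → ℝ) (β : ZMod n → ℝ), ContDiff ℝ ∞ α ∧ ∑ i, β i = 0 ∧ ∀ i t, a i t = α t + β i := by
  have hn : (n : ℝ) ≠ 0 := NeZero.ne _
  have hdiff : ∀ i, Differentiable ℝ (a i) := fun i => (ha i).differentiable (by simp)
  have hconst : ∀ i j t, a i t - a j t = a i 0 - a j 0 := fun i j t => by
    refine is_const_of_deriv_eq_zero ((hdiff i).sub (hdiff j)) (fun s => ?_) t 0
    rw [deriv_sub (hdiff i s) (hdiff j s), hd i j, sub_self]
  -- `α` is the mean over `ℤ_n`, and `β` is the deviation from it at time `0`, which is constant in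
  -- time.
  refine ⟨fun t => (n : ℝ)⁻¹ * ∑ j, a j t, fun i => a i 0 - (n : ℝ)⁻¹ * ∑ j, a j 0, ?_, ?_, ?_⟩
  · exact contDiff_const.mul (ContDiff.sum fun j _ => ha j)
  · rw [Finset.sum_sub_distrib, Finset.sum_const, Finset.card_univ, ZMod.card, nsmul_eq_mul,
      mul_inv_cancel_left₀ hn, sub_self]
  · intro i t
    have h1 : ∑ j, (a i t - a j t) = ∑ j, (a i 0 - a j 0) :=
      Finset.sum_congr rfl fun j _ => hconst i j t
    simp only [Finset.sum_sub_distrib, Finset.sum_const, Finset.card_univ, ZMod.card,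
      nsmul_eq_mul] at h1
    field_simp
    linarith

theorem re_contDiff (f : Fn n) (i : ZMod n) : ContDiff ℝ ∞ fun t => (f.1 t i).re :=
  Complex.reCLM.contDiff.comp (f.2 i)

theorem ofReal_re_apply {f : Fn n} (hf : conj f = f) (t : ℝ) (i : ZMod n) :
    ((f.1 t i).re : ℂ) = f.1 t i :=
  Complex.conj_eq_iff_re.1 (congrArg (fun F : Fn n => F.1 t i) hf)

theorem deriv_re_apply (f : Fn n) (t : ℝ) (i : ZMod n) :
    deriv (fun s => (f.1 s i).re) t = ((dtime f).1 t i).re :=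
  (Complex.reCLM.hasFDerivAt.comp_hasDerivAt t (f.differentiableAt t i).hasDerivAt).deriv

theorem apply_eq_apply_zero {f : Fn n} (hf : shift 1 f = f) (t : ℝ) (i : ZMod n) :
    f.1 t i = f.1 t 0 := by
  have := congrArg (fun F : Fn n => F.1 t 0) (shift_eq_of_shift_one hf i)
  simpa using this

theorem IsStarQLC.exists_blockMetric (hn : 3 ≤ n) [NeZero n] {g : Tens n}
    {nabla : Form1 n → Tens n} {σ : Tens n → Tens n} (hg : IsQuantumMetric g)
    (hsym : IsEdgeSymmetric g) (H : IsStarQLC g nabla σ) (E : ExtendsZn g nabla σ) :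
    ∃ (ε : ℝ) (τ α : ℝ → ℝ) (β : ZMod n → ℝ) (hτ : ContDiff ℝ ∞ τ) (hα : ContDiff ℝ ∞ α),
      (ε = 1 ∨ ε = -1) ∧ (∀ t, 0 < deriv τ t) ∧ ∑ i, β i = 0 ∧ (∀ t i, α t + β i ≠ 0) ∧
      g = blockMetric (ε : ℂ) (ofTime n τ hτ) (ofTime n α hα + ofSpace β) := by
  obtain ⟨ip, hip⟩ := hg.invertible
  obtain ⟨hgd, u, v, w, -, hc, -, hw⟩ := hip.eq_diag hn
  rw [IsEdgeSymmetric] at hsym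
  rw [hsym] at hgd
  generalize g .t .t = c at *
  generalize g .p .m = h at *
  subst hgd
  have hh : h * shift 1 w = 1 := by simpa using congrArg (shift 1) hw
  obtain ⟨hcr, hhr⟩ := dagger_diagTens_eq_iff.1 hg.real
  obtain ⟨-, -, hcs, hhs⟩ := H.eq_lc hn hc hh E
  -- As `c` is real and the same at all sites, its real part at site `0` represents it.
  obtain ⟨ε, τ, hτ, hε, hτ0, hcτ⟩ := exists_sign_and_time (re_contDiff c 0) fun t h0 =>
    (eq_inv_apply hc t 0).1 (by rw [← ofReal_re_apply hcr, h0, Complex.ofReal_zero])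
  obtain ⟨α, β, hα, hβ, hαβ⟩ := exists_splitting (fun i => (re_contDiff h i).neg) fun i j t => by
    rw [deriv.fun_neg, deriv.fun_neg, deriv_re_apply, deriv_re_apply, apply_eq_apply_zero hhs,
      apply_eq_apply_zero hhs t j]
  have ha : h = -(ofTime n α hα + ofSpace β) := by
    apply Fn.ext
    intro t i
    rw [← ofReal_re_apply hhr, Fn.coe_neg_apply, Fn.coe_add_apply, ofTime_apply, ofSpace_apply,
      ← Complex.ofReal_add, ← hαβ i t, Complex.ofReal_neg, neg_neg]
  refine ⟨ε, τ, α, β, hτ, hα, hε, hτ0, hβ, ?_, ?_⟩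
  · intro t i h0
    apply (eq_inv_apply hh t i).1
    rw [← ofReal_re_apply hhr, ← neg_eq_zero, ← Complex.ofReal_neg, hαβ i t, h0,
      Complex.ofReal_zero]
  · rw [blockMetric_ofTime, ← ha]
    congr 1
    apply Fn.ext
    intro t i
    rw [apply_eq_apply_zero hcs, ← ofReal_re_apply hcr, hcτ t, dtime_ofTime]
    simp

/-- The pointwise inverse of a nowhere vanishing function. -/
theorem exists_mul_eq_one {f : Fn n} (hf : ∀ t i, f.1 t i ≠ 0) : ∃ fi : Fn n, f * fi = 1 :=
  ⟨⟨fun t i => (f.1 t i)⁻¹, fun i => (f.2 i).inv fun t => hf t i⟩,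
    Fn.ext fun t i => mul_inv_cancel₀ (hf t i)⟩

theorem isInverseMetric_iff (hn : 3 ≤ n) {c h ci hi : Fn n} (hc : c * ci = 1) (hh : h * hi = 1)
    {ip : Tens n → Fn n} :
    IsInverseMetric (diagTens c h (shift (-1) h)) ip ↔ ip = diagPairing ci hi (shift (-1) hi) := by
  have hm : shift (-1) h * shift (-1) hi = 1 := by rw [← shift_mul, hh, shift_one]
  constructor
  · intro H
    obtain ⟨-, u, v, w, rfl, hu, hv, hw⟩ := H.eq_diag hn
    simp only [diagTens, shift_shift, add_neg_cancel, shift_zero_left] at hu hv hw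
    rw [show u = ci by linear_combination ci * hu - u * hc,
      show v = hi by linear_combination hi * hv - v * hh,
      show w = shift (-1) hi by linear_combination shift (-1) hi * hw - w * hm]
  · rintro rfl
    exact isInverseMetric_diagTens hc (by simpa using hh) hm

theorem contDiff_inv_deriv {τ : ℝ → ℝ} (hτ : ContDiff ℝ ∞ τ) (h0 : ∀ t, 0 < deriv τ t) :
    ContDiff ℝ ∞ fun t => (deriv τ t)⁻¹ :=
  (contDiff_infty_iff_deriv.1 hτ).2.inv fun t => (h0 t).ne'

theorem contDiff_dtau {τ : ℝ → ℝ} (hτ : ContDiff ℝ ∞ τ) (h0 : ∀ t, 0 < deriv τ t) {u : ℝ → ℝ}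
    (hu : ContDiff ℝ ∞ u) : ContDiff ℝ ∞ (dtau τ u) :=
  (contDiff_inv_deriv hτ h0).mul (contDiff_infty_iff_deriv.1 hu).2

/-! ### The derivative `d/dτ` as `q ∂_t` with `q = (dτ/dt)⁻¹` -/

section TimeDerivative

variable {τ : ℝ → ℝ} (hτ : ContDiff ℝ ∞ τ) (h0 : ∀ t, 0 < deriv τ t)

theorem ofTime_dtau (n : ℕ) {u : ℝ → ℝ} (hu : ContDiff ℝ ∞ u) :
    ofTime n (dtau τ u) (contDiff_dtau hτ h0 hu) =
      ofTime n _ (contDiff_inv_deriv hτ h0) * dtime (ofTime n u hu) := by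
  rw [dtime_ofTime]
  apply Fn.ext
  intro t i
  simp [dtau]

theorem dtau_apply (f : Fn n) (t : ℝ) (i : ZMod n) :
    dtau τ (fun s => f.1 s i) t = (ofTime n _ (contDiff_inv_deriv hτ h0) * dtime f).1 t i := by
  rw [dtau, Complex.real_smul]
  rfl

theorem dtau_dtau_apply (f : Fn n) (t : ℝ) (i : ZMod n) :
    dtau τ (dtau τ fun s => f.1 s i) t = (ofTime n _ (contDiff_inv_deriv hτ h0) *
      dtime (ofTime n _ (contDiff_inv_deriv hτ h0) * dtime f)).1 t i := by
  rw [show (dtau τ fun s => f.1 s i) = _ from funext fun s => dtau_apply hτ h0 f s i,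
    dtau_apply hτ h0]

end TimeDerivative

/-! ### The case `ε = -1` with `a = α + β` -/

section Cosmological

variable {τ α : ℝ → ℝ} {β : ZMod n → ℝ} (hτ : ContDiff ℝ ∞ τ) (hα : ContDiff ℝ ∞ α)

theorem dtime_mul_inv_deriv (n : ℕ) (h0 : ∀ t, 0 < deriv τ t) :
    dtime (ofTime n τ hτ) * ofTime n _ (contDiff_inv_deriv hτ h0) = 1 := by
  rw [dtime_ofTime]
  apply Fn.ext
  intro t i
  have : ((deriv τ t : ℝ) : ℂ) ≠ 0 := by exact_mod_cast (h0 t).ne'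
  simp [this]

theorem dtime_scale (β : ZMod n → ℝ) :
    dtime (ofTime n α hα + ofSpace β) = dtime (ofTime n α hα) := by
  rw [dtime_add, dtime_ofSpace, add_zero]

theorem scale_apply (β : ZMod n → ℝ) (t : ℝ) (i : ZMod n) :
    (ofTime n α hα + ofSpace β).1 t i = ((α t + β i : ℝ) : ℂ) := by
  simp

theorem blockMetric_neg_one (a : Fn n) :
    blockMetric (-1) (ofTime n τ hτ) a =
      diagTens (-(dtime (ofTime n τ hτ) * dtime (ofTime n τ hτ))) (-a) (shift (-1) (-a)) := by
  rw [blockMetric_ofTime, neg_smul, one_smul]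

theorem existsUnique_lc (hn : 3 ≤ n) {c ci h hi : Fn n} (hc : c * ci = 1) (hh : h * hi = 1)
    (hcc : conj c = c) (hhc : conj h = h) (hcs : shift 1 c = c)
    (hhs : shift 1 (dtime h) = dtime h) :
    ∃! C : (Form1 n → Tens n) × (Tens n → Tens n),
      IsStarQLC (diagTens c h (shift (-1) h)) C.1 C.2 ∧
        ExtendsZn (diagTens c h (shift (-1) h)) C.1 C.2 := by
  refine ⟨(_, _), ⟨isStarQLC_lc hc hh hcc hhc hcs hhs, extendsZn_lc hh⟩, ?_⟩
  rintro ⟨nabla, σ⟩ ⟨H, E⟩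
  obtain ⟨h1, h2, -⟩ := H.eq_lc hn hc hh E
  exact Prod.ext h1 h2

theorem twiceScalarFormula_eq (h0 : ∀ t, 0 < deriv τ t) {b : Fn n}
    (hab : (ofTime n α hα + ofSpace β) * b = 1) (t : ℝ) (i : ZMod n) :
    let a := ofTime n α hα + ofSpace β
    let q := ofTime n _ (contDiff_inv_deriv hτ h0)
    (-(q * dtime (q * dtime a)) * (b + shift (-1) b)
        + half n * half n * (q * dtime a) * (q * dtime a) * (b * b + shift (-1) (b * b))
        + (shift 1 a * shift (-1) a - a * a) * (b * b * shift 1 b)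
        + (a * shift (-2) a - shift (-1) (a * a)) * (shift (-1) (b * b) * shift (-2) b)).1 t i =
      ((twiceScalarFormula τ α β t i : ℝ) : ℂ) := by
  intro a q
  have e1 : i + -1 + -1 = i + -2 := by ring
  have hqa : q * dtime a = ofTime n (dtau τ α) (contDiff_dtau hτ h0 hα) := by
    rw [dtime_scale, ofTime_dtau hτ h0]
  have hqqa : q * dtime (q * dtime a) = ofTime n (dtau τ (dtau τ α))
      (contDiff_dtau hτ h0 (contDiff_dtau hτ h0 hα)) := by
    rw [hqa, ofTime_dtau hτ h0 n (contDiff_dtau hτ h0 hα)]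
  rw [hqqa, hqa]
  have hb : ∀ j, b.1 t j = ((α t + β j : ℝ) : ℂ)⁻¹ := fun j => by
    rw [(eq_inv_apply hab t j).2, scale_apply]
  have ha : ∀ j, a.1 t j = ((α t + β j : ℝ) : ℂ) := scale_apply hα β t
  simp only [twiceScalarFormula, sFun, Fn.coe_add_apply, Fn.coe_neg_apply,
    Fn.coe_mul_apply, shift_apply, half_apply, hb, ha, ofTime_apply, sub_eq_add_neg,
    e1, neg_add_cancel_right]
  generalize α t + β i = x
  generalize α t + β (i + 1) = y
  generalize α t + β (i + -1) = z
  generalize α t + β (i + -2) = w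
  push_cast
  ring

theorem laplacianFormula_eq (h0 : ∀ t, 0 < deriv τ t) {b : Fn n}
    (hab : (ofTime n α hα + ofSpace β) * b = 1) (f : Fn n) (t : ℝ) (i : ZMod n) :
    let a := ofTime n α hα + ofSpace β
    let q := ofTime n _ (contDiff_inv_deriv hτ h0)
    (-(q * dtime (q * dtime f)) + (b + shift (-1) b) *
        (-(half n * (q * dtime a)) * (q * dtime f) +
          (shift 1 f + shift (-1) f - (f + f)))).1 t i =
      laplacianFormula τ α β f t i := by
  intro a q
  have hqa : q * dtime a = ofTime n (dtau τ α) (contDiff_dtau hτ h0 hα) := by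
    rw [dtime_scale, ofTime_dtau hτ h0]
  have hb : ∀ j, b.1 t j = ((α t + β j : ℝ) : ℂ)⁻¹ := fun j => by
    rw [(eq_inv_apply hab t j).2, scale_apply]
  rw [hqa, laplacianFormula, dtau_dtau_apply hτ h0, dtau_apply hτ h0]
  simp only [lapZn, Fn.coe_add_apply, Fn.coe_neg_apply, q,
    Fn.coe_mul_apply, shift_apply, half_apply, hb, ofTime_apply, sub_eq_add_neg]
  push_cast
  ring

theorem sFun_add (x : ℝ) (β : ZMod n → ℝ) (i : ZMod n) :
    sFun (fun j => x + β j) i = x * lapZn β i + β (i + 1) * β (i - 1) - β i ^ 2 := by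
  simp only [sFun, lapZn]
  ring

theorem blockMetric_geometry (hn : 3 ≤ n) (h0 : ∀ t, 0 < deriv τ t)
    (ha0 : ∀ t i, α t + β i ≠ 0) {g : Tens n}
    (hg : g = blockMetric (-1) (ofTime n τ hτ) (ofTime n α hα + ofSpace β)) :
    IsQuantumMetric g ∧ IsEdgeSymmetric g ∧
      (∃! C : (Form1 n → Tens n) × (Tens n → Tens n),
        IsStarQLC g C.1 C.2 ∧ ExtendsZn g C.1 C.2) ∧
      (∃! ip, IsInverseMetric g ip) ∧
      (∀ ip nabla σ, IsInverseMetric g ip → IsStarQLC g nabla σ → ExtendsZn g nabla σ →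
        (∀ t i, 2 * (scalarCurv g ip nabla).1 t i = ((twiceScalarFormula τ α β t i : ℝ) : ℂ)) ∧
        (∀ f t i, (laplacian ip nabla f).1 t i = laplacianFormula τ α β f t i)) := by
  obtain ⟨b, hab⟩ := exists_mul_eq_one (f := ofTime n α hα + ofSpace β) fun t i => by
    rw [scale_apply]
    exact_mod_cast ha0 t i
  have hpq := dtime_mul_inv_deriv hτ n h0
  rw [blockMetric_neg_one] at hg
  subst hg
  have hS := two_scalarCurv_lc hpq hab (by rw [dtime_ofTime, shift_ofTime])
    (by rw [dtime_scale, dtime_ofTime, shift_ofTime])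
  have hL := fun f => laplacian_lc (a := ofTime n α hα + ofSpace β) (b := b) hpq f
  have hSf := twiceScalarFormula_eq hτ hα h0 hab
  have hLf := laplacianFormula_eq hτ hα h0 hab
  have hcs : shift 1 (-(dtime (ofTime n τ hτ) * dtime (ofTime n τ hτ))) =
      -(dtime (ofTime n τ hτ) * dtime (ofTime n τ hτ)) := by
    rw [dtime_ofTime, shift_neg, shift_mul, shift_ofTime]
  have hcc : conj (-(dtime (ofTime n τ hτ) * dtime (ofTime n τ hτ))) =
      -(dtime (ofTime n τ hτ) * dtime (ofTime n τ hτ)) := by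
    rw [dtime_ofTime, conj_neg, conj_mul, conj_ofTime]
  have hhs : shift 1 (dtime (-(ofTime n α hα + ofSpace β))) =
      dtime (-(ofTime n α hα + ofSpace β)) := by
    rw [dtime_neg, dtime_scale, dtime_ofTime, shift_neg, shift_ofTime]
  have hhc : conj (-(ofTime n α hα + ofSpace β)) = -(ofTime n α hα + ofSpace β) := by
    rw [conj_neg, conj_add, conj_ofTime, conj_ofSpace]
  have hc : -(dtime (ofTime n τ hτ) * dtime (ofTime n τ hτ)) *
      -(ofTime n _ (contDiff_inv_deriv hτ h0) * ofTime n _ (contDiff_inv_deriv hτ h0)) = 1 := by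
    -- With `p = dτ/dt`: `p² q² - 1 = (pq + 1)(pq - 1)`.
    linear_combination (dtime (ofTime n τ hτ) * ofTime n _ (contDiff_inv_deriv hτ h0) + 1) * hpq
  have hh : -(ofTime n α hα + ofSpace β) * -b = 1 := by linear_combination hab
  refine ⟨⟨⟨_, (isInverseMetric_iff hn hc hh).2 rfl⟩, dagger_diagTens_eq_iff.2 ⟨hcc, hhc⟩⟩, rfl,
    existsUnique_lc hn hc hh hcc hhc hcs hhs,
    ⟨_, (isInverseMetric_iff hn hc hh).2 rfl, fun ip => (isInverseMetric_iff hn hc hh).1⟩, ?_⟩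
  intro ip nabla σ hip H E
  rw [isInverseMetric_iff hn hc hh] at hip
  obtain ⟨hnab, -⟩ := H.eq_lc hn hc hh E
  subst hip hnab
  refine ⟨fun t i => ?_, fun f t i => ?_⟩
  · rw [← hSf, ← hS, two_mul, two_mul]
    rfl
  · rw [hL, hLf]

end Cosmological

end QGeom

end

theorem theorem4p1 (n : ℕ) (hn : 3 ≤ n) :
    haveI : NeZero n := ⟨by omega⟩
    -- any metric admitting such a connection is block diagonal with frozen fluctuation
    (∀ g : QGeom.Tens n, QGeom.IsQuantumMetric g → QGeom.IsEdgeSymmetric g →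
      (∃ nabla σ, QGeom.IsStarQLC g nabla σ ∧ QGeom.ExtendsZn g nabla σ) →
      ∃ (ε : ℝ) (τ α : ℝ → ℝ) (β : ZMod n → ℝ) (hτ : ContDiff ℝ ∞ τ) (hα : ContDiff ℝ ∞ α),
        (ε = 1 ∨ ε = -1) ∧ (∀ t, 0 < deriv τ t) ∧ ∑ i, β i = 0 ∧
        (∀ t i, α t + β i ≠ 0) ∧
        g = QGeom.blockMetric (ε : ℂ) (QGeom.ofTime n τ hτ)
          (QGeom.ofTime n α hα + QGeom.ofSpace β)) ∧
    -- each such metric (of Lorentzian sign) has a unique connection, with the stated geometry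
    (∀ (τ α : ℝ → ℝ) (β : ZMod n → ℝ) (hτ : ContDiff ℝ ∞ τ) (hα : ContDiff ℝ ∞ α)
      (g : QGeom.Tens n),
      (∀ t, 0 < deriv τ t) → ∑ i, β i = 0 → (∀ t i, α t + β i ≠ 0) →
      g = QGeom.blockMetric (-1) (QGeom.ofTime n τ hτ)
        (QGeom.ofTime n α hα + QGeom.ofSpace β) →
      QGeom.IsQuantumMetric g ∧ QGeom.IsEdgeSymmetric g ∧
      (∃! C : (QGeom.Form1 n → QGeom.Tens n) × (QGeom.Tens n → QGeom.Tens n),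
        QGeom.IsStarQLC g C.1 C.2 ∧ QGeom.ExtendsZn g C.1 C.2) ∧
      (∃! ip, QGeom.IsInverseMetric g ip) ∧
      (∀ ip nabla σ, QGeom.IsInverseMetric g ip →
        QGeom.IsStarQLC g nabla σ → QGeom.ExtendsZn g nabla σ →
        (∀ t i, 2 * (QGeom.scalarCurv g ip nabla).1 t i =
          ((QGeom.twiceScalarFormula τ α β t i : ℝ) : ℂ)) ∧
        (∀ f t i, (QGeom.laplacian ip nabla f).1 t i =
          QGeom.laplacianFormula τ α β f t i)) ∧
      (∀ t i, QGeom.sFun (fun j => α t + β j) i =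
        α t * QGeom.lapZn β i + β (i + 1) * β (i - 1) - β i ^ 2)) := by
  have : NeZero n := ⟨by omega⟩
  refine ⟨fun g hg hsym ⟨nabla, σ, H, E⟩ => H.exists_blockMetric hn hg hsym E, ?_⟩
  intro τ α β hτ hα g h0 _ ha0 hg
  obtain ⟨h1, h2, h3, h4, h5⟩ := QGeom.blockMetric_geometry hτ hα hn h0 ha0 hg
  exact ⟨h1, h2, h3, h4, h5, fun t i => QGeom.sFun_add (α t) β i⟩
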